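/- All manifolds and fields are smooth; spacetime metrics have signature $(+,-,-,-)$, and curvature is normalised by $(\nabla_a\nabla_b-\nabla_b\nabla_a)v^c=R^c{}_{dab}v^d$, $R_{db}=R^c{}_{dcb}$. Let $(\tilde{\mathcal M},\tilde g)$ be a 4-dimensional spacetime satisfying the vacuum Einstein equation $\tilde R_{ab}=0$. Suppose that it is asymptotically Minkowskian at spatial infinity (AMSI), that is: there are a 4-manifold $\mathcal M$ with boundary $\mathcal H$, a smooth function $\Omega$ on $\mathcal M$, and a diffeomorphism of $\tilde{\mathcal M}$ onto $\mathcal M\setminus\mathcal H$ (by which the two are identified), such that $\Omega$ does not vanish on $\tilde{\mathcal M}$ and (i) $\Omega=0$ and $\mathbf d\Omega\neq 0$ on $\mathcal H$; (ii) the fields $$q=\Omega^2\big(\tilde g+\Omega^{-4}\,\mathbf d\Omega\otimes\mathbf d\Omega\big),\qquad N=\Omega^{-4}\,\tilde g^{\sharp}(\mathbf d\Omega,\cdot)$$ on $\tilde{\mathcal M}$ extend smoothly to $\mathcal M$, and the pullback of $q$ to $\mathcal H$, again denoted $q$, has signature $(+,-,-)$; (iii) $\mathcal H$ is homeomorphic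 to $\mathbb R\times\mathbb S^2$, and $(\mathcal H,q)$ is geodesically complete. Let $F=N^a\nabla_a\Omega$. Then $F$ is constant on $\mathcal H$, and the Ricci tensor $r_{ij}$ of the 3-dimensional metric $q_{ij}$ on $\mathcal H$ satisfies $$r_{ij}=2F\,q_{ij}\qquad\text{on }\mathcal H .$$ In particular $(\mathcal H,q)$ is an Einstein space. -/

import Mathlib

open Set Manifold ContDiff Topology TopologicalSpace

noncomputable section

namespace SpatialInfinity

/-! ### Tensor fields of type (0,2) on a manifold (possibly with boundary) -/

section Tensors

variable {E : Type*} [NormedAddCommGroup E] [NormedSpace ℝ E]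
  {K : Type*} [TopologicalSpace K] (I : ModelWithCorners ℝ E K)
  (M : Type*) [TopologicalSpace M] [ChartedSpace K M]

/-- A (not necessarily continuous) field of bilinear forms on the tangent spaces of `M`. -/
abbrev BilinField : Type _ :=
  ∀ x : M, TangentSpace I x →L[ℝ] TangentSpace I x →L[ℝ] ℝ

variable {M}

/-- Smoothness of a field of bilinear forms, as a section of the bundle `T*M ⊗ T*M`; at boundary
points this is smoothness up to the boundary. -/
def IsSmoothBilinField [IsManifold I ∞ M] (b : BilinField I M) : Prop :=
  ContMDiff I (I.prod 𝓘(ℝ, E →L[ℝ] E →L[ℝ] ℝ)) ∞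
    (fun x : M ↦ Bundle.TotalSpace.mk' (E →L[ℝ] E →L[ℝ] ℝ)
      (E := fun x : M ↦ TangentSpace I x →L[ℝ] TangentSpace I x →L[ℝ] ℝ) x (b x))

/-- Smoothness of a vector field. -/
def IsSmoothVectorField [IsManifold I ∞ M] (N : ∀ x : M, TangentSpace I x) : Prop :=
  ContMDiff I I.tangent ∞ (fun x : M ↦ (⟨x, N x⟩ : TangentBundle I M))

/-- The differential `dΩ` of a real function at a point, as a covector. -/
def differential (Ω : M → ℝ) (x : M) : TangentSpace I x →L[ℝ] ℝ :=
  mfderiv I 𝓘(ℝ, ℝ) Ω x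

variable {E' : Type*} [NormedAddCommGroup E'] [NormedSpace ℝ E']
  {K' : Type*} [TopologicalSpace K'] (I' : ModelWithCorners ℝ E' K')
  {M' : Type*} [TopologicalSpace M'] [ChartedSpace K' M']

/-- The pullback `f^* b` of a field of bilinear forms, `(f^* b)(u, v) = b(df u, df v)`. -/
def pullback (f : M' → M) (b : BilinField I M) : BilinField I' M' :=
  fun x ↦ (ContinuousLinearMap.precomp ℝ (mfderiv I' I f x)).comp
    ((b (f x)).comp (mfderiv I' I f x))

theorem pullback_apply (f : M' → M) (b : BilinField I M) (x : M') (u v : TangentSpace I' x) :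
    pullback I I' f b x u v = b (f x) (mfderiv I' I f x u) (mfderiv I' I f x v) :=
  rfl

end Tensors

/-- `b` is a scalar product of signature `(+,-,…,-)` on an `n`-dimensional space: it has an
orthonormal basis with one vector of square `1` and all others of square `-1`. -/
def IsLorentzian (n : ℕ) {V : Type*} [AddCommGroup V] [Module ℝ V] [TopologicalSpace V]
    (b : V →L[ℝ] V →L[ℝ] ℝ) : Prop :=
  ∃ e : Module.Basis (Fin n) ℝ V, ∀ i j,
    b (e i) (e j) = if i = j then (if (i : ℕ) = 0 then 1 else -1) else 0

/-! ### Curvature in local coordinates -/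

section Coordinates

variable {n : ℕ}

/-- The partial derivative `∂_k f` at the point `y` of `ℝⁿ`. -/
def partialDeriv (k : Fin n) (f : EuclideanSpace ℝ (Fin n) → ℝ) (y : EuclideanSpace ℝ (Fin n)) :
    ℝ :=
  fderiv ℝ f y (EuclideanSpace.single k 1)

/-- The Christoffel symbols `Γ^k_{ij}` of the metric with components `G` on (a part of) `ℝⁿ`. -/
def christoffel (G : EuclideanSpace ℝ (Fin n) → Matrix (Fin n) (Fin n) ℝ) (k i j : Fin n)
    (y : EuclideanSpace ℝ (Fin n)) : ℝ :=
  (1 / 2) * ∑ l, (G y)⁻¹ k l *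
    (partialDeriv i (fun z ↦ G z j l) y + partialDeriv j (fun z ↦ G z i l) y
      - partialDeriv l (fun z ↦ G z i j) y)

/-- The Riemann tensor `R^c_{dab}`, with the convention
`(∇_a ∇_b - ∇_b ∇_a) v^c = R^c_{dab} v^d`. -/
def riemann (G : EuclideanSpace ℝ (Fin n) → Matrix (Fin n) (Fin n) ℝ) (c d a b : Fin n)
    (y : EuclideanSpace ℝ (Fin n)) : ℝ :=
  partialDeriv a (christoffel G c b d) y - partialDeriv b (christoffel G c a d) y
    + ∑ m, (christoffel G c a m y * christoffel G m b d y
      - christoffel G c b m y * christoffel G m a d y)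

/-- The Ricci tensor `R_{db} = R^c_{dcb}`. -/
def ricci (G : EuclideanSpace ℝ (Fin n) → Matrix (Fin n) (Fin n) ℝ) (d b : Fin n)
    (y : EuclideanSpace ℝ (Fin n)) : ℝ :=
  ∑ c, riemann G c d c b y

variable {M : Type*} [TopologicalSpace M] [ChartedSpace (EuclideanSpace ℝ (Fin n)) M]

/-- The components `g_{ij} = g(∂_i, ∂_j)` of `g` in the chart `e`, as functions of the coordinates;
meaningful on `e.target`. -/
def components (g : BilinField (𝓡 n) M) (e : OpenPartialHomeomorph M (EuclideanSpace ℝ (Fin n)))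
    (y : EuclideanSpace ℝ (Fin n)) : Matrix (Fin n) (Fin n) ℝ :=
  Matrix.of fun i j ↦ g (e.symm y)
    (mfderiv (𝓡 n) (𝓡 n) e.symm y (EuclideanSpace.single i 1))
    (mfderiv (𝓡 n) (𝓡 n) e.symm y (EuclideanSpace.single j 1))

/-- The metric `g` satisfies the tensor equation `Ric(g) = lam · g`, for a function `lam` on `M`:
the components of the two sides agree in every smooth chart. -/
def RicciEq (g : BilinField (𝓡 n) M) (lam : M → ℝ) : Prop :=
  ∀ e ∈ IsManifold.maximalAtlas (𝓡 n) ∞ M, ∀ y ∈ e.target, ∀ i j,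
    ricci (components g e) i j y = lam (e.symm y) * components g e y i j

/-- The metric `g` is Einstein: `Ric(g) = c · g` for a constant `c`. -/
def IsEinstein (g : BilinField (𝓡 n) M) : Prop := ∃ c : ℝ, RicciEq g (fun _ ↦ c)

/-- `γ : ℝ → M` is an affinely parametrised geodesic of `g`: in every smooth chart
`γ̈^k + Γ^k_{ij} γ̇^i γ̇^j = 0`. -/
def IsGeodesic (g : BilinField (𝓡 n) M) (γ : ℝ → M) : Prop :=
  ContMDiff 𝓘(ℝ, ℝ) (𝓡 n) ∞ γ ∧
    ∀ e ∈ IsManifold.maximalAtlas (𝓡 n) ∞ M, ∀ t : ℝ, γ t ∈ e.source → ∀ k : Fin n,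
      iteratedDeriv 2 (fun s ↦ e (γ s) k) t
        + ∑ i, ∑ j, christoffel (components g e) k i j (e (γ t))
          * deriv (fun s ↦ e (γ s) i) t * deriv (fun s ↦ e (γ s) j) t = 0

/-- Geodesic completeness: every tangent vector is the initial velocity of a geodesic that is
defined on all of `ℝ`. -/
def IsGeodesicallyComplete (g : BilinField (𝓡 n) M) : Prop :=
  ∀ v : TangentBundle (𝓡 n) M, ∃ γ : ℝ → M, IsGeodesic g γ ∧
    (⟨γ 0, mfderiv 𝓘(ℝ, ℝ) (𝓡 n) γ 0 (1 : ℝ)⟩ : TangentBundle (𝓡 n) M) = v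

end Coordinates

/-! ### Asymptotes at spatial infinity -/

/-- `(X, g)` is a vacuum spacetime: `g` is a smooth metric of signature `(+,-,-,-)` on the
4-manifold `X` with vanishing Ricci tensor. -/
structure IsVacuumSpacetime {X : Type*} [TopologicalSpace X]
    [ChartedSpace (EuclideanSpace ℝ (Fin 4)) X] [IsManifold (𝓡 4) ∞ X]
    (g : BilinField (𝓡 4) X) : Prop where
  smooth : IsSmoothBilinField (𝓡 4) g
  lorentzian : ∀ x, IsLorentzian 4 (g x)
  ricci_eq_zero : RicciEq g (fun _ ↦ 0)

/-- The open submanifold `M ∖ ∂M` of a 4-manifold with boundary. -/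
def interiorOpens (M : Type*) [TopologicalSpace M] [ChartedSpace (EuclideanHalfSpace 4) M]
    [IsManifold (𝓡∂ 4) ∞ M] : Opens M :=
  ⟨(𝓡∂ 4).interior M, (𝓡∂ 4).isOpen_interior (n := ∞) (by simp)⟩

/-- The vacuum spacetime `(X, g)` possesses the asymptote at spatial infinity `(H, q)`. Here `M` is
a 4-manifold with boundary; the 3-manifold `H` is the boundary of `M`, through the inclusion `ι`;
`Φ` is the diffeomorphism that identifies `X` with `M ∖ H`; `q` and `N` are the smooth fields on `M`
that extend `Ω² (g + Ω⁻⁴ dΩ ⊗ dΩ)` and `Ω⁻⁴ g^♯(dΩ, ·)` to `H`. -/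
structure IsAsymptote {X M H : Type*}
    [TopologicalSpace X] [ChartedSpace (EuclideanSpace ℝ (Fin 4)) X] [IsManifold (𝓡 4) ∞ X]
    [TopologicalSpace M] [ChartedSpace (EuclideanHalfSpace 4) M] [IsManifold (𝓡∂ 4) ∞ M]
    [TopologicalSpace H] [ChartedSpace (EuclideanSpace ℝ (Fin 3)) H] [IsManifold (𝓡 3) ∞ H]
    (g : BilinField (𝓡 4) X) (Φ : X ≃ₘ^∞⟮𝓡 4, 𝓡∂ 4⟯ (interiorOpens M)) (ι : H → M)
    (Ω : M → ℝ) (q : BilinField (𝓡∂ 4) M) (N : ∀ p : M, TangentSpace (𝓡∂ 4) p) : Prop where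
  vacuum : IsVacuumSpacetime g
  ι_embedding : IsSmoothEmbedding (𝓡 3) (𝓡∂ 4) ∞ ι
  range_ι : range ι = (𝓡∂ 4).boundary M
  Ω_smooth : ContMDiff (𝓡∂ 4) 𝓘(ℝ, ℝ) ∞ Ω
  Ω_ne_zero : ∀ x : X, Ω (Φ x) ≠ 0
  Ω_eq_zero : ∀ p : H, Ω (ι p) = 0
  dΩ_ne_zero : ∀ p : H, differential (𝓡∂ 4) Ω (ι p) ≠ 0
  q_smooth : IsSmoothBilinField (𝓡∂ 4) q
  q_eq : ∀ (x : X) (u v : TangentSpace (𝓡 4) x),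
    pullback (𝓡∂ 4) (𝓡 4) (fun x : X ↦ (Φ x : M)) q x u v =
      Ω (Φ x) ^ 2 * (g x u v + (Ω (Φ x) ^ 4)⁻¹ *
        (differential (𝓡 4) (fun x : X ↦ Ω (Φ x)) x u *
          differential (𝓡 4) (fun x : X ↦ Ω (Φ x)) x v))
  N_smooth : IsSmoothVectorField (𝓡∂ 4) N
  -- `w = Ω⁻⁴ g^♯(dΩ, ·)` is the vector with `g(w, ·) = Ω⁻⁴ dΩ`, and `N` is its image in `M`
  N_eq : ∀ x : X, ∃ w : TangentSpace (𝓡 4) x,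
    (∀ v, g x w v = (Ω (Φ x) ^ 4)⁻¹ * differential (𝓡 4) (fun x : X ↦ Ω (Φ x)) x v) ∧
      N (Φ x : M) = mfderiv (𝓡 4) (𝓡∂ 4) (fun x : X ↦ (Φ x : M)) x w
  q_lorentzian : ∀ p : H, IsLorentzian 3 (pullback (𝓡∂ 4) (𝓡 3) ι q p)

/-- The vacuum spacetime `(X, g)` is asymptotically Minkowskian at spatial infinity, with asymptote
`(H, q)`: moreover `H` has the topology of `ℝ × S²` and is geodesically complete. -/
structure IsAMSI {X M H : Type*}
    [TopologicalSpace X] [ChartedSpace (EuclideanSpace ℝ (Fin 4)) X] [IsManifold (𝓡 4) ∞ X]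
    [TopologicalSpace M] [ChartedSpace (EuclideanHalfSpace 4) M] [IsManifold (𝓡∂ 4) ∞ M]
    [TopologicalSpace H] [ChartedSpace (EuclideanSpace ℝ (Fin 3)) H] [IsManifold (𝓡 3) ∞ H]
    (g : BilinField (𝓡 4) X) (Φ : X ≃ₘ^∞⟮𝓡 4, 𝓡∂ 4⟯ (interiorOpens M)) (ι : H → M)
    (Ω : M → ℝ) (q : BilinField (𝓡∂ 4) M) (N : ∀ p : M, TangentSpace (𝓡∂ 4) p) : Prop
    extends IsAsymptote g Φ ι Ω q N where
  topology : Nonempty (H ≃ₜ ℝ × Metric.sphere (0 : EuclideanSpace ℝ (Fin 3)) 1)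
  complete : IsGeodesicallyComplete (pullback (𝓡∂ 4) (𝓡 3) ι q)

/-- The function `F = N^a ∇_a Ω` on `M`. -/
def digamma {M : Type*} [TopologicalSpace M] [ChartedSpace (EuclideanHalfSpace 4) M]
    (Ω : M → ℝ) (N : ∀ p : M, TangentSpace (𝓡∂ 4) p) (p : M) : ℝ :=
  differential (𝓡∂ 4) Ω p (N p)

end SpatialInfinity

end

/-!
Near a boundary point, take a coordinate frame `X₀, …, X₃` with `X_a Ω = δ_{a0}`, in which the
physical metric is `Ω⁻² q - Ω⁻⁴ dΩ²`. Up to the terms `-Ω⁻¹ (δ_{a0} δ^k_b + δ_{b0} δ^k_a)`, its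
Christoffel symbols are symbols `C` that stay smooth at `Ω = 0`: the Levi-Civita connection is
projectively equivalent to one that is regular up to the boundary. A projective change by the closed
form `-d log Ω` alters the Ricci tensor by `-3 B⁰`, where `C⁰ = Ω B⁰` with `B` regular, so the
vacuum equation extends to `Ω = 0` by density of the interior as `Ric(C) = 3 B⁰`. On the boundary
`C` restricts to the Levi-Civita connection of the induced metric, `B⁰_{ij} = -q_{ij}`, and `Ric(C)`
differs from the intrinsic Ricci tensor by `B⁰_{ij}`. Hence `r_{ij} = -2 q_{ij}`.

The value `F = -1` is also a limit: in the interior `Ω² q(v, N) = (1 + F) dΩ(v)`, and the left-hand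
side vanishes on the boundary.
-/

noncomputable section

namespace SpatialInfinity

/-! ### Derivatives along vector fields -/

section FrameDeriv

variable {E : Type*} [NormedAddCommGroup E] [NormedSpace ℝ E]
  {K : Type*} [TopologicalSpace K] {I : ModelWithCorners ℝ E K}
  {M : Type*} [TopologicalSpace M] [ChartedSpace K M]
  {E' : Type*} [NormedAddCommGroup E'] [NormedSpace ℝ E']
  {K' : Type*} [TopologicalSpace K'] {I' : ModelWithCorners ℝ E' K'}
  {M' : Type*} [TopologicalSpace M'] [ChartedSpace K' M']

theorem differential_comp_apply {f : M → ℝ} {σ : M' → M} {z : M'}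
    (hf : MDiffAt f (σ z)) (hσ : MDifferentiableAt I' I σ z) (v : TangentSpace I' z) :
    differential I' (fun y ↦ f (σ y)) z v = differential I f (σ z) (mfderiv I' I σ z v) :=
  mfderiv_comp_apply z hf hσ v

/-- The derivative `X f` of a real function `f` along a vector field `X`. -/
def frameDeriv (X : ∀ m : M, TangentSpace I m) (f : M → ℝ) (m : M) : ℝ :=
  differential I f m (X m)

variable {X : ∀ m : M, TangentSpace I m} {f g : M → ℝ} {m : M}

theorem frameDeriv_congr (h : f =ᶠ[𝓝 m] g) : frameDeriv X f m = frameDeriv X g m := by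
  rw [frameDeriv, differential, h.mfderiv_eq]
  rfl

theorem frameDeriv_add (hf : MDiffAt f m) (hg : MDiffAt g m) :
    frameDeriv X (fun x ↦ f x + g x) m = frameDeriv X f m + frameDeriv X g m :=
  DFunLike.congr_fun (mfderiv_add hf hg) (X m)

theorem frameDeriv_mul (hf : MDiffAt f m) (hg : MDiffAt g m) :
    frameDeriv X (fun x ↦ f x * g x) m = f m * frameDeriv X g m + g m * frameDeriv X f m :=
  DFunLike.congr_fun (hf.hasMFDerivAt.mul hg.hasMFDerivAt).mfderiv (X m)

theorem frameDeriv_comp {φ : ℝ → ℝ} {φ' : ℝ} (hφ : HasDerivAt φ φ' (f m)) (hf : MDiffAt f m) :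
    frameDeriv X (fun x ↦ φ (f x)) m = φ' * frameDeriv X f m := by
  refine (DFunLike.congr_fun
    (hφ.hasFDerivAt.hasMFDerivAt.comp m hf.hasMFDerivAt).mfderiv (X m)).trans ?_
  exact mul_comm (differential I f m (X m)) φ'

theorem contMDiffOn_frameDeriv [IsManifold I ∞ M] {O : Set M} (hO : IsOpen O)
    (hX : CMDiff[O] ∞ (T% X)) (hf : CMDiff[O] ∞ f) : CMDiff[O] ∞ (frameDeriv X f) := by
  have htangent := hf.contMDiffOn_tangentMapWithin (m := ∞) (by simp) hO.uniqueMDiffOn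
  refine ((contMDiff_snd_tangentBundle_modelSpace ℝ 𝓘(ℝ, ℝ) (n := ∞)).comp_contMDiffOn
    (htangent.comp hX fun m hm ↦ hm)).congr fun m hm ↦ ?_
  exact DFunLike.congr_fun (mfderivWithin_of_isOpen hO hm).symm (X m)

end FrameDeriv

/-! ### Connections in frames -/

section FrameCurvature

variable {E : Type*} [NormedAddCommGroup E] [NormedSpace ℝ E]
  {K : Type*} [TopologicalSpace K] {I : ModelWithCorners ℝ E K}
  {M : Type*} [TopologicalSpace M] [ChartedSpace K M] {ν : Type*}

/-- The Christoffel symbols of the first kind `[ij, l]` of the metric with components `G` in a frame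
`X`, by the formula for a coordinate frame. -/
def frameChristoffelFirst (X : ν → ∀ m : M, TangentSpace I m) (G : M → Matrix ν ν ℝ)
    (i j l : ν) (m : M) : ℝ :=
  1 / 2 * (frameDeriv (X i) (fun x ↦ G x j l) m + frameDeriv (X j) (fun x ↦ G x i l) m
    - frameDeriv (X l) (fun x ↦ G x i j) m)

variable {X : ν → ∀ m : M, TangentSpace I m}

theorem contMDiffOn_frameChristoffelFirst [IsManifold I ∞ M] {G : M → Matrix ν ν ℝ} {O : Set M}
    (hO : IsOpen O) (hX : ∀ a, CMDiff[O] ∞ (T% (X a)))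
    (hG : ∀ i j, CMDiff[O] ∞ (fun m ↦ G m i j)) (i j l : ν) :
    CMDiff[O] ∞ (frameChristoffelFirst X G i j l) :=
  contMDiffOn_const.mul (((contMDiffOn_frameDeriv hO (hX i) (hG j l)).add
    (contMDiffOn_frameDeriv hO (hX j) (hG i l))).sub (contMDiffOn_frameDeriv hO (hX l) (hG i j)))

theorem frameChristoffelFirst_comm {G : M → Matrix ν ν ℝ} {m : M}
    (hG : ∀ᶠ x in 𝓝 m, (G x).IsSymm) (i j l : ν) :
    frameChristoffelFirst X G i j l m = frameChristoffelFirst X G j i l m := by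
  have hij : (fun x ↦ G x i j) =ᶠ[𝓝 m] fun x ↦ G x j i := hG.mono fun x hx ↦ hx.apply j i
  rw [frameChristoffelFirst, frameChristoffelFirst, frameDeriv_congr hij, add_comm]

variable [Fintype ν]

/-- The Christoffel symbols `Γ^k_{ij}` of the metric with components `G` in a frame `X`, by the
formula for a coordinate frame. -/
def frameChristoffel [DecidableEq ν] (X : ν → ∀ m : M, TangentSpace I m) (G : M → Matrix ν ν ℝ)
    (k i j : ν) (m : M) : ℝ :=
  ∑ l, (G m)⁻¹ k l * frameChristoffelFirst X G i j l m

/-- The part of the Ricci tensor `R_{db}` that is quadratic in the connection coefficients. -/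
def ricciQuadratic (Γ : ν → ν → ν → ℝ) (d b : ν) : ℝ :=
  ∑ c, ∑ e, (Γ c c e * Γ e b d - Γ c b e * Γ e c d)

theorem ricciQuadratic_eq_sub (Γ : ν → ν → ν → ℝ) (d b : ν) :
    ricciQuadratic Γ d b =
      ∑ e, (∑ c, Γ c c e) * Γ e b d - ∑ c, ∑ e, Γ c b e * Γ e c d := by
  simp only [ricciQuadratic, Finset.sum_sub_distrib, Finset.sum_mul]
  rw [Finset.sum_comm]

/-- The Ricci tensor `R_{db}` of the connection with coefficients `Γ^k_{ij}` in a frame `X`, by the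
formula for a coordinate frame. -/
def frameRicci (X : ν → ∀ m : M, TangentSpace I m) (Γ : ν → ν → ν → M → ℝ) (d b : ν) (m : M) : ℝ :=
  ∑ c, (frameDeriv (X c) (Γ c b d) m - frameDeriv (X b) (Γ c c d) m)
    + ricciQuadratic (fun k i j ↦ Γ k i j m) d b

theorem frameRicci_congr {Γ Γ' : ν → ν → ν → M → ℝ} {m : M}
    (h : ∀ k i j, Γ k i j =ᶠ[𝓝 m] Γ' k i j) (d b : ν) :
    frameRicci X Γ d b m = frameRicci X Γ' d b m := by
  simp only [frameRicci, frameDeriv_congr (h _ _ _), (h _ _ _).eq_of_nhds]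

theorem continuousOn_frameRicci [IsManifold I ∞ M] {Γ : ν → ν → ν → M → ℝ} {O : Set M}
    (hO : IsOpen O) (hX : ∀ a, CMDiff[O] ∞ (T% (X a))) (hΓ : ∀ k i j, CMDiff[O] ∞ (Γ k i j))
    (d b : ν) : ContinuousOn (frameRicci X Γ d b) O := by
  have hderiv : ∀ a k i j, ContinuousOn (frameDeriv (X a) (Γ k i j)) O := fun a k i j ↦
    (contMDiffOn_frameDeriv hO (hX a) (hΓ k i j)).continuousOn
  have hcont : ∀ k i j, ContinuousOn (Γ k i j) O := fun k i j ↦ (hΓ k i j).continuousOn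
  unfold frameRicci ricciQuadratic
  fun_prop

end FrameCurvature

/-! ### Parametrisations adapted to a frame -/

section Adapted

variable {E : Type*} [NormedAddCommGroup E] [NormedSpace ℝ E]
  {K : Type*} [TopologicalSpace K] {I : ModelWithCorners ℝ E K}
  {M : Type*} [TopologicalSpace M] [ChartedSpace K M] {n : ℕ}

/-- The parametrisation `σ` is adapted to the frame `X` at `z`: its coordinate vectors are the
vectors of the frame. The number of coordinates may be smaller than the dimension of `M`. -/
structure IsAdaptedAt (X : Fin n → ∀ m : M, TangentSpace I m) (σ : EuclideanSpace ℝ (Fin n) → M)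
    (z : EuclideanSpace ℝ (Fin n)) : Prop where
  mdifferentiableAt : MDifferentiableAt (𝓡 n) I σ z
  mfderiv_single : ∀ a, mfderiv (𝓡 n) I σ z (EuclideanSpace.single a 1) = X a (σ z)

theorem partialDeriv_eq_differential (a : Fin n) (f : EuclideanSpace ℝ (Fin n) → ℝ)
    (z : EuclideanSpace ℝ (Fin n)) :
    partialDeriv a f z = differential (𝓡 n) f z (EuclideanSpace.single a (1 : ℝ)) := by
  rw [partialDeriv, differential, mfderiv_eq_fderiv]
  rfl

theorem partialDeriv_congr {f g : EuclideanSpace ℝ (Fin n) → ℝ} {z : EuclideanSpace ℝ (Fin n)}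
    (h : f =ᶠ[𝓝 z] g) (a : Fin n) : partialDeriv a f z = partialDeriv a g z := by
  rw [partialDeriv, partialDeriv, h.fderiv_eq]

namespace IsAdaptedAt

variable {X : Fin n → ∀ m : M, TangentSpace I m} {σ : EuclideanSpace ℝ (Fin n) → M}
  {z : EuclideanSpace ℝ (Fin n)}

theorem partialDeriv_comp (h : IsAdaptedAt X σ z) {f : M → ℝ} (hf : MDiffAt f (σ z)) (a : Fin n) :
    partialDeriv a (fun y ↦ f (σ y)) z = frameDeriv (X a) f (σ z) :=
  (partialDeriv_eq_differential a _ z).trans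
    ((differential_comp_apply hf h.mdifferentiableAt _).trans
      (congrArg (differential I f (σ z)) (h.mfderiv_single a)))

theorem christoffel_eq (h : IsAdaptedAt X σ z) {G : M → Matrix (Fin n) (Fin n) ℝ}
    (hG : ∀ i j, MDiffAt (fun m ↦ G m i j) (σ z))
    {G' : EuclideanSpace ℝ (Fin n) → Matrix (Fin n) (Fin n) ℝ} (hG' : G' =ᶠ[𝓝 z] G ∘ σ)
    (k i j : Fin n) : christoffel G' k i j z = frameChristoffel X G k i j (σ z) := by
  have hderiv : ∀ a i j, partialDeriv a (fun y ↦ G' y i j) z =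
      frameDeriv (X a) (fun m ↦ G m i j) (σ z) := fun a i j ↦
    (partialDeriv_congr (hG'.mono fun y hy ↦ by rw [hy]; rfl) a).trans
      (h.partialDeriv_comp (hG i j) a)
  simp only [christoffel, frameChristoffel, frameChristoffelFirst, hderiv, hG'.eq_of_nhds,
    Function.comp_apply, Finset.mul_sum]
  exact Finset.sum_congr rfl fun l _ ↦ by ring

theorem ricci_eq (h : IsAdaptedAt X σ z) {Γ : Fin n → Fin n → Fin n → M → ℝ}
    (hΓ : ∀ k i j, MDiffAt (Γ k i j) (σ z))
    {G : EuclideanSpace ℝ (Fin n) → Matrix (Fin n) (Fin n) ℝ}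
    (hG : ∀ k i j, christoffel G k i j =ᶠ[𝓝 z] Γ k i j ∘ σ) (d b : Fin n) :
    ricci G d b z = frameRicci X Γ d b (σ z) := by
  have hderiv : ∀ a k i j, partialDeriv a (christoffel G k i j) z =
      frameDeriv (X a) (Γ k i j) (σ z) := fun a k i j ↦
    (partialDeriv_congr (hG k i j) a).trans (h.partialDeriv_comp (hΓ k i j) a)
  simp only [ricci, riemann, frameRicci, ricciQuadratic, hderiv, (hG _ _ _).eq_of_nhds,
    Function.comp_apply, Finset.sum_add_distrib]

end IsAdaptedAt

end Adapted

/-! ### Projective changes of connection -/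

section Projective

variable {ν : Type*} [DecidableEq ν]

/-- The projective change `Γ^k_{ij} + ψ_i δ^k_j + ψ_j δ^k_i` of the connection coefficients `Γ`. -/
def projectiveChange (Γ : ν → ν → ν → ℝ) (ψ : ν → ℝ) (k i j : ν) : ℝ :=
  Γ k i j + (if k = j then ψ i else 0) + if k = i then ψ j else 0

variable {E : Type*} [NormedAddCommGroup E] [NormedSpace ℝ E]
  {K : Type*} [TopologicalSpace K] {I : ModelWithCorners ℝ E K}
  {M : Type*} [TopologicalSpace M] [ChartedSpace K M]

theorem frameDeriv_projectiveChange {X : ∀ m : M, TangentSpace I m}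
    {Γ : ν → ν → ν → M → ℝ} {ψ : ν → M → ℝ} {m : M} (hΓ : ∀ k i j, MDiffAt (Γ k i j) m)
    (hψ : ∀ i, MDiffAt (ψ i) m) (k i j : ν) :
    frameDeriv X (fun x ↦ projectiveChange (fun k i j ↦ Γ k i j x) (fun i ↦ ψ i x) k i j) m =
      projectiveChange (fun k i j ↦ frameDeriv X (Γ k i j) m) (fun i ↦ frameDeriv X (ψ i) m)
        k i j := by
  have hterm : ∀ (i : ν) (P : Prop) [Decidable P],
      MDiffAt (fun x ↦ if P then ψ i x else 0) m ∧
        frameDeriv X (fun x ↦ if P then ψ i x else 0) m =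
          if P then frameDeriv X (ψ i) m else 0 := by
    intro i P _
    by_cases hP : P
    · simpa only [hP, if_true] using ⟨hψ i, trivial⟩
    · simpa only [hP, if_false] using ⟨mdifferentiableAt_const, by
        rw [frameDeriv, differential, mfderiv_const]; rfl⟩
  unfold projectiveChange
  rw [← (hterm i _).2, ← (hterm j _).2, ← frameDeriv_add (hΓ k i j) (hterm i _).1]
  exact frameDeriv_add ((hΓ k i j).add (hterm i _).1) (hterm j _).1

variable [Fintype ν]

theorem sum_mul_projectiveChange (Γ : ν → ν → ν → ℝ) (ψ T : ν → ℝ) (i j : ν) :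
    ∑ k, T k * projectiveChange Γ ψ k i j = ∑ k, T k * Γ k i j + T j * ψ i + T i * ψ j := by
  simp only [projectiveChange, mul_add, mul_ite, mul_zero, Finset.sum_add_distrib,
    Finset.sum_ite_eq', Finset.mem_univ, if_true]

theorem sum_sum_projectiveChange_mul (Γ : ν → ν → ν → ℝ) (ψ : ν → ℝ) (T : ν → ν → ℝ) (i : ν) :
    ∑ k, ∑ j, projectiveChange Γ ψ k i j * T j k =
      ∑ k, ∑ j, Γ k i j * T j k + ψ i * ∑ j, T j j + ∑ j, ψ j * T j i := by
  rw [Finset.sum_comm, Finset.sum_comm (f := fun k j ↦ Γ k i j * T j k)]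
  simp only [projectiveChange, add_mul, ite_mul, zero_mul, Finset.sum_add_distrib,
    Finset.sum_ite_eq', Finset.mem_univ, if_true, Finset.mul_sum]

theorem sum_projectiveChange_self (Γ : ν → ν → ν → ℝ) (ψ : ν → ℝ) (j : ν) :
    ∑ k, projectiveChange Γ ψ k k j = ∑ k, Γ k k j + (Fintype.card ν + 1) * ψ j := by
  simp only [projectiveChange, Finset.sum_add_distrib, Finset.sum_ite_eq', Finset.mem_univ,
    if_true, Finset.sum_const, Finset.card_univ, nsmul_eq_mul]
  ring

theorem ricciQuadratic_projectiveChange {Γ : ν → ν → ν → ℝ} (hΓ : ∀ k i j, Γ k i j = Γ k j i)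
    (ψ : ν → ℝ) (d b : ν) :
    ricciQuadratic (projectiveChange Γ ψ) d b =
      ricciQuadratic Γ d b + (Fintype.card ν - 1) * (∑ c, ψ c * Γ c b d + ψ b * ψ d) := by
  have hcross : ∑ c, ∑ e, projectiveChange Γ ψ c b e * projectiveChange Γ ψ e c d =
      ∑ c, ∑ e, Γ c b e * Γ e c d + 2 * ∑ c, ψ c * Γ c b d + ψ b * ∑ c, Γ c c d
        + ψ d * ∑ c, Γ c c b + (Fintype.card ν + 3) * (ψ b * ψ d) := by
    rw [sum_sum_projectiveChange_mul]
    simp only [sum_mul_projectiveChange, sum_projectiveChange_self, Finset.sum_add_distrib, hΓ _ b,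
      ← Finset.sum_mul]
    simp only [mul_comm (Γ _ _ _) (ψ _)]
    ring
  rw [ricciQuadratic_eq_sub, ricciQuadratic_eq_sub, sum_mul_projectiveChange, hcross]
  simp only [sum_projectiveChange_self, add_mul, Finset.sum_add_distrib, mul_assoc,
    ← Finset.mul_sum]
  ring

theorem frameRicci_projectiveChange {X : ν → ∀ m : M, TangentSpace I m}
    {Γ : ν → ν → ν → M → ℝ} {ψ : ν → M → ℝ} {m : M} (hΓ : ∀ k i j, MDiffAt (Γ k i j) m)
    (hψ : ∀ i, MDiffAt (ψ i) m) (hsymm : ∀ k i j, Γ k i j m = Γ k j i m) (d b : ν) :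
    frameRicci X (fun k i j x ↦ projectiveChange (fun k i j ↦ Γ k i j x) (fun i ↦ ψ i x) k i j)
        d b m =
      frameRicci X Γ d b m + (frameDeriv (X d) (ψ b) m - frameDeriv (X b) (ψ d) m)
        - (Fintype.card ν - 1) *
          (frameDeriv (X b) (ψ d) m - ∑ c, ψ c m * Γ c b d m - ψ b m * ψ d m) := by
  simp only [frameRicci, frameDeriv_projectiveChange hΓ hψ, ricciQuadratic_projectiveChange hsymm,
    Finset.sum_sub_distrib, sum_projectiveChange_self]
  simp only [projectiveChange, Finset.sum_add_distrib, Finset.sum_ite_eq', Finset.mem_univ, if_true]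
  ring

end Projective

/-! ### The metric `w⁻² q - w⁻⁴ dw²` -/

section CollarMetric

variable {n : ℕ}

/-- The components of `w⁻² q - w⁻⁴ dw ⊗ dw` in a frame whose zeroth covector is `dw`. -/
def physicalMetric (w : ℝ) (q : Matrix (Fin (n + 1)) (Fin (n + 1)) ℝ) :
    Matrix (Fin (n + 1)) (Fin (n + 1)) ℝ :=
  (w ^ 2)⁻¹ • q - (w ^ 4)⁻¹ • Matrix.single 0 0 1

theorem physicalMetric_apply (w : ℝ) (q : Matrix (Fin (n + 1)) (Fin (n + 1)) ℝ)
    (i j : Fin (n + 1)) :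
    physicalMetric w q i j =
      (w ^ 2)⁻¹ * q i j - (w ^ 4)⁻¹ * (Matrix.single 0 0 1 : Matrix _ _ ℝ) i j := by
  simp only [physicalMetric, Matrix.sub_apply, Matrix.smul_apply, smul_eq_mul]

theorem isSymm_physicalMetric (w : ℝ) {q : Matrix (Fin (n + 1)) (Fin (n + 1)) ℝ} (hq : q.IsSymm) :
    (physicalMetric w q).IsSymm :=
  (hq.smul _).sub (by rw [Matrix.IsSymm, Matrix.transpose_smul, Matrix.transpose_single])

/-- The diagonal entries `w, 1, …, 1` of the rescaling that makes `w² g` regular at `w = 0`. -/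
def collarScale (n : ℕ) (w : ℝ) : Fin (n + 1) → ℝ :=
  Fin.cons w 1

/-- The rescaled components `E (w² g) E` of the physical metric `g`, with `E = diag(w, 1, …, 1)`. In
terms of `q` they make sense also at `w = 0`, where they are `diag(-1, q_tan)`. -/
def scaledMetric (w : ℝ) (q : Matrix (Fin (n + 1)) (Fin (n + 1)) ℝ) :
    Matrix (Fin (n + 1)) (Fin (n + 1)) ℝ :=
  Matrix.diagonal (collarScale n w) * q * Matrix.diagonal (collarScale n w) - Matrix.single 0 0 1

theorem scaledMetric_apply (w : ℝ) (q : Matrix (Fin (n + 1)) (Fin (n + 1)) ℝ)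
    (i j : Fin (n + 1)) :
    scaledMetric w q i j = collarScale n w i * q i j * collarScale n w j
      - (Matrix.single 0 0 1 : Matrix _ _ ℝ) i j := by
  simp only [scaledMetric, Matrix.sub_apply, Matrix.mul_diagonal, Matrix.diagonal_mul]

theorem isSymm_scaledMetric (w : ℝ) {q : Matrix (Fin (n + 1)) (Fin (n + 1)) ℝ} (hq : q.IsSymm) :
    (scaledMetric w q).IsSymm := by
  rw [Matrix.IsSymm, scaledMetric, Matrix.transpose_sub, Matrix.transpose_mul, Matrix.transpose_mul,
    hq.eq, Matrix.diagonal_transpose, Matrix.transpose_single, Matrix.mul_assoc]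

theorem diagonal_mul_physicalMetric_mul_diagonal {w : ℝ} (hw : w ≠ 0)
    (q : Matrix (Fin (n + 1)) (Fin (n + 1)) ℝ) :
    Matrix.diagonal (collarScale n w) * physicalMetric w q * Matrix.diagonal (collarScale n w) =
      (w ^ 2)⁻¹ • scaledMetric w q := by
  ext i j
  simp only [Matrix.mul_diagonal, Matrix.diagonal_mul, Matrix.smul_apply, scaledMetric_apply,
    physicalMetric_apply, smul_eq_mul, Matrix.single_apply, mul_sub, sub_mul]
  split_ifs with h
  · rw [← h.1, ← h.2, collarScale, Fin.cons_zero]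
    field_simp
  · ring

theorem det_physicalMetric_ne_zero {w : ℝ} (hw : w ≠ 0)
    {q : Matrix (Fin (n + 1)) (Fin (n + 1)) ℝ} (hdet : (scaledMetric w q).det ≠ 0) :
    (physicalMetric w q).det ≠ 0 := by
  intro hphys
  have h := congrArg Matrix.det (diagonal_mul_physicalMetric_mul_diagonal hw q)
  rw [Matrix.det_mul, Matrix.det_mul, hphys, mul_zero, zero_mul, Matrix.det_smul] at h
  exact mul_ne_zero (pow_ne_zero _ (inv_ne_zero (pow_ne_zero 2 hw))) hdet h.symm

theorem inv_physicalMetric {w : ℝ} (hw : w ≠ 0) {q : Matrix (Fin (n + 1)) (Fin (n + 1)) ℝ}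
    (hdet : (scaledMetric w q).det ≠ 0) :
    (physicalMetric w q)⁻¹ = w ^ 2 • (Matrix.diagonal (collarScale n w) * (scaledMetric w q)⁻¹ *
      Matrix.diagonal (collarScale n w)) := by
  set E := Matrix.diagonal (collarScale n w)
  have hE : IsUnit E := by
    rw [Matrix.isUnit_iff_isUnit_det, Matrix.det_diagonal, isUnit_iff_ne_zero, Fin.prod_univ_succ]
    simpa [collarScale] using hw
  refine Matrix.inv_eq_right_inv (hE.mul_left_cancel ?_)
  calc E * (physicalMetric w q * w ^ 2 • (E * (scaledMetric w q)⁻¹ * E))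
      = w ^ 2 • (E * physicalMetric w q * E * (scaledMetric w q)⁻¹ * E) := by
        simp only [Matrix.mul_smul, Matrix.mul_assoc]
    _ = scaledMetric w q * (scaledMetric w q)⁻¹ * E := by
        rw [diagonal_mul_physicalMetric_mul_diagonal hw, Matrix.smul_mul, Matrix.smul_mul,
          smul_inv_smul₀ (pow_ne_zero 2 hw)]
    _ = E * 1 := by
        rw [Matrix.mul_nonsing_inv _ (isUnit_iff_ne_zero.2 hdet), Matrix.one_mul, Matrix.mul_one]

theorem scaledMetric_zero_left (q : Matrix (Fin (n + 1)) (Fin (n + 1)) ℝ) (j : Fin (n + 1)) :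
    scaledMetric 0 q 0 j = if j = 0 then -1 else 0 := by
  simp [scaledMetric_apply, collarScale, Matrix.single_apply, eq_comm, apply_ite]

theorem scaledMetric_succ_succ (w : ℝ) (q : Matrix (Fin (n + 1)) (Fin (n + 1)) ℝ) (i j : Fin n) :
    scaledMetric w q i.succ j.succ = q i.succ j.succ := by
  simp [scaledMetric_apply, collarScale, (Fin.succ_ne_zero _).symm]

theorem det_scaledMetric_zero (q : Matrix (Fin (n + 1)) (Fin (n + 1)) ℝ) :
    (scaledMetric 0 q).det = -(q.submatrix Fin.succ Fin.succ).det := by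
  have hminor : (scaledMetric 0 q).submatrix Fin.succ Fin.succ = q.submatrix Fin.succ Fin.succ :=
    Matrix.ext fun i j ↦ scaledMetric_succ_succ 0 q i j
  rw [Matrix.det_succ_row_zero, Fin.sum_univ_succ, Finset.sum_eq_zero fun j _ ↦ by
    rw [scaledMetric_zero_left, if_neg (Fin.succ_ne_zero j), mul_zero, zero_mul]]
  simp [scaledMetric_zero_left, hminor]

variable {q : Matrix (Fin (n + 1)) (Fin (n + 1)) ℝ}

theorem inv_scaledMetric_zero_left (hdet : (scaledMetric 0 q).det ≠ 0) (j : Fin (n + 1)) :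
    (scaledMetric 0 q)⁻¹ 0 j = if j = 0 then -1 else 0 := by
  have h := congrFun (congrFun (Matrix.mul_nonsing_inv _ (isUnit_iff_ne_zero.2 hdet)) 0) j
  simp only [Matrix.mul_apply, scaledMetric_zero_left, ite_mul, neg_one_mul, zero_mul,
    Finset.sum_ite_eq', Finset.mem_univ, if_true, Matrix.one_apply, eq_comm (a := (0 : Fin _))] at h
  rw [neg_eq_iff_eq_neg.1 h]
  split_ifs <;> simp

theorem inv_scaledMetric_zero_right (hq : q.IsSymm) (hdet : (scaledMetric 0 q).det ≠ 0)
    (i : Fin (n + 1)) : (scaledMetric 0 q)⁻¹ i 0 = if i = 0 then -1 else 0 := by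
  rw [(isSymm_scaledMetric 0 hq).inv.apply, inv_scaledMetric_zero_left hdet]

theorem inv_scaledMetric_zero_succ_succ (hdet : (scaledMetric 0 q).det ≠ 0) (i j : Fin n) :
    (scaledMetric 0 q)⁻¹ i.succ j.succ = (q.submatrix Fin.succ Fin.succ)⁻¹ i j := by
  have hinv : q.submatrix Fin.succ Fin.succ *
      (scaledMetric 0 q)⁻¹.submatrix Fin.succ Fin.succ = 1 := by
    ext i j
    have h := congrFun (congrFun
      (Matrix.mul_nonsing_inv _ (isUnit_iff_ne_zero.2 hdet)) i.succ) j.succ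
    simpa [Matrix.mul_apply, Fin.sum_univ_succ, inv_scaledMetric_zero_left hdet,
      scaledMetric_succ_succ, Matrix.one_apply] using h
  rw [Matrix.inv_eq_right_inv hinv, Matrix.submatrix_apply]

end CollarMetric

/-! ### The physical connection near the boundary -/

section CollarConnection

variable {E : Type*} [NormedAddCommGroup E] [NormedSpace ℝ E]
  {K : Type*} [TopologicalSpace K] {I : ModelWithCorners ℝ E K}
  {M : Type*} [TopologicalSpace M] [ChartedSpace K M] {n : ℕ}

/-- The coefficients `B^k_{ab}` of which `collarChristoffel` is a rescaling. The component
`B^0_{ab}` is the second fundamental form of the boundary up to sign. -/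
def collarForm (X : Fin (n + 1) → ∀ m : M, TangentSpace I m) (w : M → ℝ)
    (q : M → Matrix (Fin (n + 1)) (Fin (n + 1)) ℝ) (k a b : Fin (n + 1)) (m : M) : ℝ :=
  ∑ l, (scaledMetric (w m) (q m))⁻¹ k l * collarScale n (w m) l * frameChristoffelFirst X q a b l m
    + (scaledMetric (w m) (q m))⁻¹ k 0 * q m a b

/-- The coefficients of the connection that is projectively equivalent to the Levi-Civita connection
of `w⁻² q - w⁻⁴ dw²` and regular at `w = 0`. -/
def collarChristoffel (X : Fin (n + 1) → ∀ m : M, TangentSpace I m) (w : M → ℝ)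
    (q : M → Matrix (Fin (n + 1)) (Fin (n + 1)) ℝ) (k a b : Fin (n + 1)) (m : M) : ℝ :=
  collarScale n (w m) k * collarForm X w q k a b m

variable {X : Fin (n + 1) → ∀ m : M, TangentSpace I m} {w : M → ℝ}
  {q : M → Matrix (Fin (n + 1)) (Fin (n + 1)) ℝ} {m : M}

theorem collarChristoffel_zero_eq_zero (hw : w m = 0) (a b : Fin (n + 1)) :
    collarChristoffel X w q 0 a b m = 0 := by
  rw [collarChristoffel, hw, collarScale, Fin.cons_zero, zero_mul]

theorem frameDeriv_physicalMetric (hw : w m ≠ 0) (hwd : MDiffAt w m)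
    (hqd : ∀ i j, MDiffAt (fun x ↦ q x i j) m) (a b l : Fin (n + 1)) :
    frameDeriv (X a) (fun x ↦ physicalMetric (w x) (q x) b l) m =
      (w m ^ 2)⁻¹ * frameDeriv (X a) (fun x ↦ q x b l) m
        + (-2 * (w m ^ 3)⁻¹ * q m b l
          + 4 * (w m ^ 5)⁻¹ * (Matrix.single 0 0 1 : Matrix (Fin (n + 1)) (Fin (n + 1)) ℝ) b l)
          * frameDeriv (X a) w m := by
  set s := (Matrix.single 0 0 1 : Matrix (Fin (n + 1)) (Fin (n + 1)) ℝ) b l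
  have hpow : ∀ k : ℕ, HasDerivAt (fun t : ℝ ↦ (t ^ k)⁻¹) (-k * (w m ^ (k + 1))⁻¹) (w m) := by
    intro k
    refine ((hasDerivAt_pow k (w m)).inv (pow_ne_zero k hw)).congr_deriv ?_
    cases k with
    | zero => simp
    | succ k => rw [Nat.add_sub_cancel]; field_simp; ring
  have hpole : HasDerivAt (fun t : ℝ ↦ -(t ^ 4)⁻¹ * s) (4 * (w m ^ 5)⁻¹ * s) (w m) :=
    ((hpow 4).neg.mul_const s).congr_deriv (by push_cast; ring)
  have hscale : MDiffAt (fun x ↦ (w x ^ 2)⁻¹) m :=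
    (hpow 2).differentiableAt.comp_mdifferentiableAt hwd
  have hentry : (fun x ↦ physicalMetric (w x) (q x) b l) =
      fun x ↦ (w x ^ 2)⁻¹ * q x b l + -(w x ^ 4)⁻¹ * s := by
    funext x
    rw [physicalMetric_apply, sub_eq_add_neg, neg_mul]
  have hfirst : MDiffAt (fun x ↦ (w x ^ 2)⁻¹ * q x b l) m := hscale.mul (hqd b l)
  have hsecond : MDiffAt (fun x ↦ -(w x ^ 4)⁻¹ * s) m :=
    hpole.differentiableAt.comp_mdifferentiableAt hwd
  rw [hentry, frameDeriv_add hfirst hsecond, frameDeriv_mul hscale (hqd b l),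
    frameDeriv_comp (hpow 2) hwd, frameDeriv_comp hpole hwd]
  push_cast
  ring

theorem frameChristoffelFirst_physicalMetric (hw : w m ≠ 0) (hwd : MDiffAt w m)
    (hqd : ∀ i j, MDiffAt (fun x ↦ q x i j) m)
    (hX : ∀ a, frameDeriv (X a) w m = if a = 0 then 1 else 0) (a b l : Fin (n + 1)) :
    frameChristoffelFirst X (fun x ↦ physicalMetric (w x) (q x)) a b l m =
      (w m ^ 2)⁻¹ * frameChristoffelFirst X q a b l m
        + (if a = 0 then -(w m)⁻¹ else 0) * physicalMetric (w m) (q m) b l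
        + (if b = 0 then -(w m)⁻¹ else 0) * physicalMetric (w m) (q m) a l
        + (w m ^ 3)⁻¹ * (if l = 0 then q m a b else 0) := by
  simp only [frameChristoffelFirst, frameDeriv_physicalMetric hw hwd hqd, hX]
  simp only [physicalMetric_apply, Matrix.single_apply, eq_comm (a := (0 : Fin (n + 1)))]
  by_cases ha : a = 0 <;> by_cases hb : b = 0 <;> by_cases hl : l = 0 <;>
    simp only [ha, hb, hl, and_self, and_true, and_false, if_true, if_false] <;> field_simp <;> ring

theorem sum_nonsing_inv_mul_of_isSymm {ν : Type*} [Fintype ν] [DecidableEq ν] {g : Matrix ν ν ℝ}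
    (hg : g.IsSymm) (hdet : g.det ≠ 0) (k j : ν) :
    ∑ l, g⁻¹ k l * g j l = if k = j then 1 else 0 := by
  rw [← Matrix.one_apply, ← Matrix.nonsing_inv_mul g (isUnit_iff_ne_zero.2 hdet), Matrix.mul_apply]
  exact Finset.sum_congr rfl fun l _ ↦ congrArg (g⁻¹ k l * ·) (hg.apply l j)

theorem frameChristoffel_physicalMetric (hw : w m ≠ 0) (hwd : MDiffAt w m)
    (hqd : ∀ i j, MDiffAt (fun x ↦ q x i j) m)
    (hX : ∀ a, frameDeriv (X a) w m = if a = 0 then 1 else 0) (hq : (q m).IsSymm)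
    (hdet : (scaledMetric (w m) (q m)).det ≠ 0) (k a b : Fin (n + 1)) :
    frameChristoffel X (fun x ↦ physicalMetric (w x) (q x)) k a b m =
      projectiveChange (fun k i j ↦ collarChristoffel X w q k i j m)
        (fun i ↦ if i = 0 then -(w m)⁻¹ else 0) k a b := by
  set g := physicalMetric (w m) (q m)
  have hcontract : ∀ j, ∑ l, g⁻¹ k l * g j l = if k = j then 1 else 0 :=
    sum_nonsing_inv_mul_of_isSymm (isSymm_physicalMetric (w m) hq)
      (det_physicalMetric_ne_zero hw hdet) k
  have hinv : ∀ l, g⁻¹ k l = w m ^ 2 * (collarScale n (w m) k *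
      (scaledMetric (w m) (q m))⁻¹ k l * collarScale n (w m) l) := fun l ↦ by
    rw [inv_physicalMetric hw hdet, Matrix.smul_apply, Matrix.mul_diagonal, Matrix.diagonal_mul,
      smul_eq_mul]
  have hpole : g⁻¹ k 0 * (w m ^ 3)⁻¹ =
      collarScale n (w m) k * (scaledMetric (w m) (q m))⁻¹ k 0 := by
    rw [hinv, collarScale, Fin.cons_zero]
    field_simp
  have hregular : ∀ l, g⁻¹ k l * (w m ^ 2)⁻¹ =
      collarScale n (w m) k * ((scaledMetric (w m) (q m))⁻¹ k l * collarScale n (w m) l) :=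
    fun l ↦ by
      rw [hinv]
      field_simp
  calc frameChristoffel X (fun x ↦ physicalMetric (w x) (q x)) k a b m
      = ∑ l, (g⁻¹ k l * (w m ^ 2)⁻¹ * frameChristoffelFirst X q a b l m
          + (if a = 0 then -(w m)⁻¹ else 0) * (g⁻¹ k l * g b l)
          + (if b = 0 then -(w m)⁻¹ else 0) * (g⁻¹ k l * g a l)
          + if l = 0 then g⁻¹ k 0 * (w m ^ 3)⁻¹ * q m a b else 0) :=
        Finset.sum_congr rfl fun l _ ↦ by
          rw [frameChristoffelFirst_physicalMetric hw hwd hqd hX]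
          by_cases hl : l = 0
          · simp only [hl, if_true]; ring
          · simp only [hl, if_false]; ring
    _ = projectiveChange (fun k i j ↦ collarChristoffel X w q k i j m)
          (fun i ↦ if i = 0 then -(w m)⁻¹ else 0) k a b := by
        simp only [Finset.sum_add_distrib, ← Finset.mul_sum, hcontract, hregular, hpole,
          Finset.sum_ite_eq', Finset.mem_univ, if_true, mul_ite, mul_one, mul_zero, mul_assoc]
        rw [projectiveChange, collarChristoffel, collarForm]
        simp only [mul_add, mul_assoc]
        ring

end CollarConnection

/-! ### The limit of the Ricci tensor at the boundary -/

section CollarRicci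

theorem eqOn_of_eqOn_inter_dense {Y Z : Type*} [TopologicalSpace Y] [TopologicalSpace Z] [T2Space Z]
    {O s : Set Y} {f g : Y → Z} (hs : Dense s) (hO : IsOpen O) (hf : ContinuousOn f O)
    (hg : ContinuousOn g O) (h : EqOn f g (O ∩ s)) : EqOn f g O :=
  h.of_subset_closure hf hg inter_subset_left (hs.open_subset_closure_inter hO)

variable {E : Type*} [NormedAddCommGroup E] [NormedSpace ℝ E]
  {K : Type*} [TopologicalSpace K] {I : ModelWithCorners ℝ E K}
  {M : Type*} [TopologicalSpace M] [ChartedSpace K M]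

theorem contMDiffOn_matrix_det {ν : Type*} [Fintype ν] [DecidableEq ν] {A : M → Matrix ν ν ℝ}
    {O : Set M} (hA : ∀ i j, CMDiff[O] ∞ (fun m ↦ A m i j)) :
    CMDiff[O] ∞ (fun m ↦ (A m).det) := by
  simp only [Matrix.det_apply']
  exact contMDiffOn_finsetSum fun s _ ↦ contMDiffOn_const.mul
    (contMDiffOn_finsetProd fun i _ ↦ hA _ _)

theorem contMDiffOn_matrix_inv {ν : Type*} [Fintype ν] [DecidableEq ν] {A : M → Matrix ν ν ℝ}
    {O : Set M} (hA : ∀ i j, CMDiff[O] ∞ (fun m ↦ A m i j)) (hdet : ∀ m ∈ O, (A m).det ≠ 0)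
    (i j : ν) : CMDiff[O] ∞ (fun m ↦ (A m)⁻¹ i j) := by
  simp only [Matrix.inv_def, Matrix.smul_apply, Ring.inverse_eq_inv', smul_eq_mul,
    Matrix.adjugate_apply]
  refine ((contMDiffOn_matrix_det hA).inv₀ hdet).mul (contMDiffOn_matrix_det fun k l ↦ ?_)
  by_cases hk : k = j
  · subst hk
    simpa using contMDiffOn_const
  · simpa [Matrix.updateRow_apply, hk] using hA k l

variable {n : ℕ}

theorem contMDiffOn_collarScale {w : M → ℝ} {O : Set M} (hw : CMDiff[O] ∞ w) (a : Fin (n + 1)) :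
    CMDiff[O] ∞ (fun m ↦ collarScale n (w m) a) := by
  cases a using Fin.cases with
  | zero => exact hw
  | succ i => exact contMDiffOn_const

theorem contMDiffOn_scaledMetric {w : M → ℝ} {q : M → Matrix (Fin (n + 1)) (Fin (n + 1)) ℝ}
    {O : Set M} (hw : CMDiff[O] ∞ w) (hq : ∀ i j, CMDiff[O] ∞ (fun m ↦ q m i j))
    (i j : Fin (n + 1)) : CMDiff[O] ∞ (fun m ↦ scaledMetric (w m) (q m) i j) := by
  simp only [scaledMetric_apply]
  exact (((contMDiffOn_collarScale hw i).mul (hq i j)).mul (contMDiffOn_collarScale hw j)).sub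
    contMDiffOn_const

theorem contMDiffOn_physicalMetric {w : M → ℝ} {q : M → Matrix (Fin (n + 1)) (Fin (n + 1)) ℝ}
    {O : Set M} (hw : CMDiff[O] ∞ w) (hw0 : ∀ m ∈ O, w m ≠ 0)
    (hq : ∀ i j, CMDiff[O] ∞ (fun m ↦ q m i j)) (i j : Fin (n + 1)) :
    CMDiff[O] ∞ (fun m ↦ physicalMetric (w m) (q m) i j) := by
  simp only [physicalMetric_apply]
  exact (((hw.pow 2).inv₀ fun m hm ↦ pow_ne_zero 2 (hw0 m hm)).mul (hq i j)).sub
    (((hw.pow 4).inv₀ fun m hm ↦ pow_ne_zero 4 (hw0 m hm)).mul contMDiffOn_const)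

/-- Over the open set `O`, the smooth frame `X` satisfies `X_a w = δ_{a0}`, and the smooth symmetric
components `q` make `w⁻² q - w⁻⁴ dw²`, rescaled, nondegenerate up to `w = 0`. -/
structure IsCollarFrame (X : Fin (n + 1) → ∀ m : M, TangentSpace I m) (w : M → ℝ)
    (q : M → Matrix (Fin (n + 1)) (Fin (n + 1)) ℝ) (O : Set M) [IsManifold I ∞ M] : Prop where
  isOpen : IsOpen O
  contMDiffOn_frame : ∀ a, CMDiff[O] ∞ (T% (X a))
  contMDiffOn_w : CMDiff[O] ∞ w
  contMDiffOn_q : ∀ i j, CMDiff[O] ∞ (fun m ↦ q m i j)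
  frameDeriv_w : ∀ m ∈ O, ∀ a, frameDeriv (X a) w m = if a = 0 then 1 else 0
  isSymm_q : ∀ m ∈ O, (q m).IsSymm
  det_scaledMetric_ne_zero : ∀ m ∈ O, (scaledMetric (w m) (q m)).det ≠ 0

namespace IsCollarFrame

variable [IsManifold I ∞ M] {X : Fin (n + 1) → ∀ m : M, TangentSpace I m} {w : M → ℝ}
  {q : M → Matrix (Fin (n + 1)) (Fin (n + 1)) ℝ} {O : Set M} {m : M}

theorem mdifferentiableAt (h : IsCollarFrame X w q O) (hm : m ∈ O) {f : M → ℝ}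
    (hf : CMDiff[O] ∞ f) : MDiffAt f m :=
  (hf.contMDiffAt (h.isOpen.mem_nhds hm)).mdifferentiableAt (by simp)

theorem contMDiffOn_collarForm (h : IsCollarFrame X w q O) (k a b : Fin (n + 1)) :
    CMDiff[O] ∞ (collarForm X w q k a b) := by
  have hinv := contMDiffOn_matrix_inv (contMDiffOn_scaledMetric h.contMDiffOn_w h.contMDiffOn_q)
    h.det_scaledMetric_ne_zero
  exact (contMDiffOn_finsetSum fun l _ ↦
      ((hinv k l).mul (contMDiffOn_collarScale h.contMDiffOn_w l)).mul
        (contMDiffOn_frameChristoffelFirst h.isOpen h.contMDiffOn_frame h.contMDiffOn_q a b l)).add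
    ((hinv k 0).mul (h.contMDiffOn_q a b))

theorem contMDiffOn_collarChristoffel (h : IsCollarFrame X w q O) (k a b : Fin (n + 1)) :
    CMDiff[O] ∞ (collarChristoffel X w q k a b) :=
  (contMDiffOn_collarScale h.contMDiffOn_w k).mul (h.contMDiffOn_collarForm k a b)

theorem collarChristoffel_comm (h : IsCollarFrame X w q O) (hm : m ∈ O) (k a b : Fin (n + 1)) :
    collarChristoffel X w q k a b m = collarChristoffel X w q k b a m := by
  have hsymm : ∀ᶠ x in 𝓝 m, (q x).IsSymm := (h.isOpen.eventually_mem hm).mono h.isSymm_q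
  rw [collarChristoffel, collarChristoffel, collarForm, collarForm, (h.isSymm_q m hm).apply]
  simp only [frameChristoffelFirst_comm hsymm a b]

theorem frameChristoffel_physicalMetric (h : IsCollarFrame X w q O) (hm : m ∈ O) (hw : w m ≠ 0)
    (k a b : Fin (n + 1)) :
    frameChristoffel X (fun x ↦ physicalMetric (w x) (q x)) k a b m =
      projectiveChange (fun k i j ↦ collarChristoffel X w q k i j m)
        (fun i ↦ if i = 0 then -(w m)⁻¹ else 0) k a b :=
  SpatialInfinity.frameChristoffel_physicalMetric hw (h.mdifferentiableAt hm h.contMDiffOn_w)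
    (fun i j ↦ h.mdifferentiableAt hm (h.contMDiffOn_q i j)) (h.frameDeriv_w m hm)
    (h.isSymm_q m hm) (h.det_scaledMetric_ne_zero m hm) k a b

theorem frameDeriv_neg_inv (h : IsCollarFrame X w q O) (hm : m ∈ O) (hw : w m ≠ 0)
    (a i : Fin (n + 1)) :
    MDiffAt (fun x ↦ if i = 0 then -(w x)⁻¹ else 0) m ∧
      frameDeriv (X a) (fun x ↦ if i = 0 then -(w x)⁻¹ else 0) m =
        if i = 0 ∧ a = 0 then (w m ^ 2)⁻¹ else 0 := by
  have hwd := h.mdifferentiableAt hm h.contMDiffOn_w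
  have hφ : HasDerivAt (fun t : ℝ ↦ if i = 0 then -t⁻¹ else 0)
      (if i = 0 then (w m ^ 2)⁻¹ else 0) (w m) := by
    by_cases hi : i = 0
    · simp only [hi, if_true]
      exact (hasDerivAt_inv hw).neg.congr_deriv (neg_neg _)
    · simpa only [hi, if_false] using hasDerivAt_const _ _
  refine ⟨hφ.differentiableAt.comp_mdifferentiableAt hwd, ?_⟩
  rw [frameDeriv_comp hφ hwd, h.frameDeriv_w m hm]
  by_cases hi : i = 0 <;> by_cases ha : a = 0 <;> simp [hi, ha]

theorem frameRicci_physicalMetric (h : IsCollarFrame X w q O) (hm : m ∈ O) (hw : w m ≠ 0)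
    (d b : Fin (n + 1)) :
    frameRicci X (frameChristoffel X fun x ↦ physicalMetric (w x) (q x)) d b m =
      frameRicci X (collarChristoffel X w q) d b m - n * collarForm X w q 0 b d m := by
  have hnear : ∀ᶠ x in 𝓝 m, x ∈ O ∧ w x ≠ 0 := (h.isOpen.eventually_mem hm).and
    ((h.mdifferentiableAt hm h.contMDiffOn_w).continuousAt.eventually_ne hw)
  rw [frameRicci_congr fun k i j ↦ hnear.mono fun x hx ↦
      h.frameChristoffel_physicalMetric hx.1 hx.2 k i j,
    frameRicci_projectiveChange
      (fun k i j ↦ h.mdifferentiableAt hm (h.contMDiffOn_collarChristoffel k i j))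
      (fun i ↦ (h.frameDeriv_neg_inv hm hw 0 i).1) (h.collarChristoffel_comm hm)]
  have hcontract : ∑ c, (if c = 0 then -(w m)⁻¹ else 0) * collarChristoffel X w q c b d m =
      -collarForm X w q 0 b d m := by
    simp only [ite_mul, zero_mul, Finset.sum_ite_eq', Finset.mem_univ, if_true, collarChristoffel,
      collarScale, Fin.cons_zero]
    field_simp
  rw [hcontract, (h.frameDeriv_neg_inv hm hw d b).2, (h.frameDeriv_neg_inv hm hw b d).2,
    Fintype.card_fin, Nat.cast_add_one]
  by_cases hd : d = 0 <;> by_cases hb : b = 0 <;>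
    simp only [hd, hb, and_self, and_true, and_false, if_true, if_false] <;> ring

theorem collarForm_zero_succ_succ (h : IsCollarFrame X w q O) (hm : m ∈ O) (hw : w m = 0)
    (i j : Fin n) : collarForm X w q 0 i.succ j.succ m = -q m i.succ j.succ := by
  have hdet := h.det_scaledMetric_ne_zero m hm
  rw [hw] at hdet
  simp [collarForm, hw, inv_scaledMetric_zero_left hdet, collarScale]

theorem collarChristoffel_succ_succ_succ (h : IsCollarFrame X w q O) (hm : m ∈ O) (hw : w m = 0)
    (k i j : Fin n) :
    collarChristoffel X w q k.succ i.succ j.succ m =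
      frameChristoffel (fun a ↦ X a.succ) (fun x ↦ (q x).submatrix Fin.succ Fin.succ) k i j m := by
  have hdet := h.det_scaledMetric_ne_zero m hm
  rw [hw] at hdet
  simp [collarChristoffel, collarForm, hw, Fin.sum_univ_succ, collarScale,
    inv_scaledMetric_zero_right (h.isSymm_q m hm) hdet, inv_scaledMetric_zero_succ_succ hdet,
    frameChristoffel, frameChristoffelFirst]

theorem frameDeriv_collarChristoffel_zero (h : IsCollarFrame X w q O) (hm : m ∈ O) (hw : w m = 0)
    (c a b : Fin (n + 1)) :
    frameDeriv (X c) (collarChristoffel X w q 0 a b) m =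
      if c = 0 then collarForm X w q 0 a b m else 0 := by
  refine (frameDeriv_mul (h.mdifferentiableAt hm h.contMDiffOn_w)
    (h.mdifferentiableAt hm (h.contMDiffOn_collarForm 0 a b))).trans ?_
  rw [hw, h.frameDeriv_w m hm, zero_mul, zero_add, mul_ite, mul_one, mul_zero]

theorem frameRicci_collarChristoffel_succ_succ (h : IsCollarFrame X w q O) (hm : m ∈ O)
    (hw : w m = 0) (d b : Fin n) :
    frameRicci X (collarChristoffel X w q) d.succ b.succ m =
      frameRicci (fun a ↦ X a.succ)
          (fun k i j ↦ collarChristoffel X w q k.succ i.succ j.succ) d b m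
        - q m b.succ d.succ := by
  simp [frameRicci, ricciQuadratic, Fin.sum_univ_succ, h.frameDeriv_collarChristoffel_zero hm hw,
    collarChristoffel_zero_eq_zero hw, h.collarForm_zero_succ_succ hm hw]
  ring

theorem frameRicci_eq_of_ricci_physicalMetric_eq_zero (h : IsCollarFrame X w q O)
    (hdense : Dense {x | w x ≠ 0})
    (hflat : ∀ x ∈ O, w x ≠ 0 → ∀ d b,
      frameRicci X (frameChristoffel X fun x ↦ physicalMetric (w x) (q x)) d b x = 0)
    (hm : m ∈ O) (hw : w m = 0) (d b : Fin n) :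
    frameRicci (fun a ↦ X a.succ) (fun k i j ↦ collarChristoffel X w q k.succ i.succ j.succ) d b m =
      -(n - 1) * q m d.succ b.succ := by
  have hlimit : EqOn (frameRicci X (collarChristoffel X w q) d.succ b.succ)
      (fun x ↦ n * collarForm X w q 0 b.succ d.succ x) O :=
    eqOn_of_eqOn_inter_dense hdense h.isOpen
      (continuousOn_frameRicci h.isOpen h.contMDiffOn_frame h.contMDiffOn_collarChristoffel _ _)
      (continuousOn_const.mul (h.contMDiffOn_collarForm _ _ _).continuousOn)
      fun x ⟨hx, hwx⟩ ↦ by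
        rw [← sub_eq_zero, ← h.frameRicci_physicalMetric hx hwx, hflat x hx hwx]
  have hm' := hlimit hm
  simp only [h.frameRicci_collarChristoffel_succ_succ hm hw, h.collarForm_zero_succ_succ hm hw,
    (h.isSymm_q m hm).apply d.succ b.succ] at hm'
  linear_combination hm'

end IsCollarFrame

end CollarRicci

/-! ### Coordinate frames -/

section CoordinateFrame

variable {E : Type*} [NormedAddCommGroup E] [NormedSpace ℝ E]
  {K : Type*} [TopologicalSpace K] {I : ModelWithCorners ℝ E K}
  {M : Type*} [TopologicalSpace M] [ChartedSpace K M]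
  {ν : Type*} {t : ν → M → ℝ} {X : ν → ∀ m : M, TangentSpace I m} {O : Set M}

theorem differential_sum_smul [Fintype ν] (f : M → ℝ) (c : ν → ℝ) (m : M) :
    differential I f m (∑ k, c k • X k m) = ∑ k, frameDeriv (X k) f m * c k := by
  simp [map_sum, frameDeriv, mul_comm]

variable [IsManifold I ∞ M] [DecidableEq ν]

/-- Over the open set `O`, the smooth functions `t` are coordinates and `X` is the frame of their
coordinate vector fields. Unlike for charts, `O` may contain boundary points of `M`. -/
structure IsCoordinateFrame (t : ν → M → ℝ) (X : ν → ∀ m : M, TangentSpace I m) (O : Set M) :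
    Prop where
  isOpen : IsOpen O
  contMDiffOn_coord : ∀ a, CMDiff[O] ∞ (t a)
  contMDiffOn_frame : ∀ a, CMDiff[O] ∞ (T% (X a))
  frameDeriv_coord : ∀ m ∈ O, ∀ a b, frameDeriv (X a) (t b) m = if b = a then 1 else 0
  eq_zero : ∀ m ∈ O, ∀ v : TangentSpace I m, (∀ b, differential I (t b) m v = 0) → v = 0

namespace IsCoordinateFrame

theorem mdifferentiableAt_coord (h : IsCoordinateFrame t X O) {m : M} (hm : m ∈ O) (a : ν) :
    MDiffAt (t a) m :=
  ((h.contMDiffOn_coord a).contMDiffAt (h.isOpen.mem_nhds hm)).mdifferentiableAt (by simp)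

theorem mono (h : IsCoordinateFrame t X O) {O' : Set M} (hO' : IsOpen O') (hsub : O' ⊆ O) :
    IsCoordinateFrame t X O' where
  isOpen := hO'
  contMDiffOn_coord a := (h.contMDiffOn_coord a).mono hsub
  contMDiffOn_frame a := (h.contMDiffOn_frame a).mono hsub
  frameDeriv_coord m hm := h.frameDeriv_coord m (hsub hm)
  eq_zero m hm := h.eq_zero m (hsub hm)

theorem eq_frame (h : IsCoordinateFrame t X O) {m : M} (hm : m ∈ O) {a : ν} {v : TangentSpace I m}
    (hv : ∀ b, differential I (t b) m v = if b = a then 1 else 0) : v = X a m := by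
  refine sub_eq_zero.1 (h.eq_zero m hm _ fun b ↦ ?_)
  rw [map_sub, hv, sub_eq_zero]
  exact (h.frameDeriv_coord m hm a b).symm

theorem isAdaptedAt (h : IsCoordinateFrame t X O) {k : ℕ} {τ : Fin k → ν}
    {σ : EuclideanSpace ℝ (Fin k) → M} {z : EuclideanSpace ℝ (Fin k)} (hz : σ z ∈ O)
    (hσ : MDifferentiableAt (𝓡 k) I σ z)
    (hcoord : ∀ a b, partialDeriv a (fun y ↦ t b (σ y)) z = if b = τ a then 1 else 0) :
    IsAdaptedAt (fun a ↦ X (τ a)) σ z where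
  mdifferentiableAt := hσ
  mfderiv_single a := h.eq_frame hz fun b ↦
    (differential_comp_apply (h.mdifferentiableAt_coord hz b) hσ _).symm.trans
      ((partialDeriv_eq_differential a _ z).symm.trans (hcoord a b))

end IsCoordinateFrame

theorem isCoordinateFrame_inv_smul [Fintype ν] (hO : IsOpen O) (hX : IsLocalFrameOn I E ∞ X O)
    (ht : ∀ a, CMDiff[O] ∞ (t a))
    (hdet : ∀ m ∈ O, (Matrix.of fun a k ↦ frameDeriv (X k) (t a) m).det ≠ 0) :
    IsCoordinateFrame t
      (fun a m ↦ ∑ k, (Matrix.of fun a k ↦ frameDeriv (X k) (t a) m)⁻¹ k a • X k m) O where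
  isOpen := hO
  contMDiffOn_coord := ht
  contMDiffOn_frame a := ContMDiffOn.sum_section fun k _ ↦
    (contMDiffOn_matrix_inv (fun a k ↦ contMDiffOn_frameDeriv hO (hX.contMDiffOn k) (ht a)) hdet
      k a).smul_section (hX.contMDiffOn k)
  frameDeriv_coord m hm a b :=
    (differential_sum_smul (t b) _ m).trans <| by
      rw [← Matrix.one_apply, ← Matrix.mul_nonsing_inv _ (isUnit_iff_ne_zero.2 (hdet m hm)),
        Matrix.mul_apply]
      rfl
  eq_zero m hm v hv := by
    have hsum : v = ∑ k, (hX.toBasisAt hm).repr v k • X k m := by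
      simpa only [IsLocalFrameOn.toBasisAt_coe] using ((hX.toBasisAt hm).sum_repr v).symm
    have hrepr : ⇑((hX.toBasisAt hm).repr v) = 0 :=
      Matrix.eq_zero_of_mulVec_eq_zero (hdet m hm) <| funext fun b ↦
        (differential_sum_smul (t b) _ m).symm.trans ((congrArg _ hsum.symm).trans (hv b))
    simpa [hrepr] using hsum

theorem exists_isCoordinateFrame [Finite ν] (b : Module.Basis ν ℝ E) (hO : IsOpen O) {p : M}
    (hp : p ∈ O) (ht : ∀ a, CMDiff[O] ∞ (t a))
    (hinj : ∀ v : TangentSpace I p, (∀ a, differential I (t a) p v = 0) → v = 0) :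
    ∃ (X : ν → ∀ m : M, TangentSpace I m) (O' : Set M), p ∈ O' ∧ IsCoordinateFrame t X O' := by
  have : Fintype ν := Fintype.ofFinite ν
  set e := trivializationAt E (TangentSpace I : M → Type _) p
  have hO₁ : IsOpen (O ∩ e.baseSet) := hO.inter e.open_baseSet
  have hp₁ : p ∈ O ∩ e.baseSet := ⟨hp, FiberBundle.mem_baseSet_trivializationAt' p⟩
  have hY : IsLocalFrameOn I E ∞ (e.localFrame b) (O ∩ e.baseSet) :=
    (e.isLocalFrameOn_localFrame_baseSet I ∞ b).mono inter_subset_right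
  set A : M → Matrix ν ν ℝ := fun m ↦ Matrix.of fun a k ↦ frameDeriv (e.localFrame b k) (t a) m
  have hA : ContinuousOn (fun m ↦ (A m).det) (O ∩ e.baseSet) :=
    (contMDiffOn_matrix_det fun a k ↦ contMDiffOn_frameDeriv hO₁ (hY.contMDiffOn k)
      ((ht a).mono inter_subset_left)).continuousOn
  have hAp : (A p).det ≠ 0 := fun h0 ↦ by
    obtain ⟨c, hc, hAc⟩ := Matrix.exists_mulVec_eq_zero_iff.2 h0
    refine hc (funext (Fintype.linearIndependent_iff.1 (hY.linearIndependent hp₁) c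
      (hinj _ fun a ↦ ?_)))
    exact (differential_sum_smul (t a) c p).trans (congrFun hAc a)
  exact ⟨_, (O ∩ e.baseSet) ∩ (fun m ↦ (A m).det) ⁻¹' {0}ᶜ, ⟨hp₁, hAp⟩, isCoordinateFrame_inv_smul
    (hA.isOpen_inter_preimage hO₁ isOpen_compl_singleton) (hY.mono inter_subset_left)
    (fun a ↦ (ht a).mono (inter_subset_left.trans inter_subset_left)) fun m hm ↦ hm.2⟩

end CoordinateFrame

/-! ### Charts from coordinate functions -/

section Charts

theorem partialDeriv_coord {n : ℕ} (a b : Fin n) (z : EuclideanSpace ℝ (Fin n)) :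
    partialDeriv a (fun y ↦ y b) z = if b = a then 1 else 0 := by
  have : HasFDerivAt (fun y : EuclideanSpace ℝ (Fin n) ↦ y b)
      (EuclideanSpace.proj b : EuclideanSpace ℝ (Fin n) →L[ℝ] ℝ) z :=
    (EuclideanSpace.proj b : EuclideanSpace ℝ (Fin n) →L[ℝ] ℝ).hasFDerivAt
  rw [partialDeriv, this.fderiv]
  simp

theorem exists_openPartialHomeomorph_of_fderiv_injective {E : Type*} [NormedAddCommGroup E]
    [NormedSpace ℝ E] [FiniteDimensional ℝ E] {F : E → E} {T : Set E} (hT : IsOpen T)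
    (hF : ContDiffOn ℝ ∞ F T) {z : E} (hz : z ∈ T) (hinj : Function.Injective (fderiv ℝ F z)) :
    ∃ θ : OpenPartialHomeomorph E E, z ∈ θ.source ∧ θ.source ⊆ T ∧ ⇑θ = F ∧
      ContDiffOn ℝ ∞ θ.symm θ.target := by
  have : CompleteSpace E := FiniteDimensional.complete ℝ E
  have hFat : ∀ y ∈ T, ContDiffAt ℝ ∞ F y := fun y hy ↦ hF.contDiffAt (hT.mem_nhds hy)
  have hderiv : ∀ y ∈ T, HasFDerivAt F (fderiv ℝ F y) y := fun y hy ↦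
    ((hFat y hy).differentiableAt (by simp)).hasFDerivAt
  let L : E ≃L[ℝ] E := (LinearEquiv.ofInjectiveEndo _ hinj).toContinuousLinearEquiv
  have hL : (L : E →L[ℝ] E) = fderiv ℝ F z := by ext; rfl
  have hFz : HasFDerivAt F (L : E →L[ℝ] E) z := hL ▸ hderiv z hz
  have hT' : IsOpen (T ∩ fderiv ℝ F ⁻¹' range ((↑) : (E ≃L[ℝ] E) → E →L[ℝ] E)) :=
    (hF.continuousOn_fderiv_of_isOpen hT (by simp)).isOpen_inter_preimage hT
      ContinuousLinearEquiv.isOpen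
  let θ := ((hFat z hz).toOpenPartialHomeomorph F hFz (by simp)).restrOpen _ hT'
  refine ⟨θ, ⟨(hFat z hz).mem_toOpenPartialHomeomorph_source hFz (by simp), hz, L, hL⟩,
    fun y hy ↦ hy.2.1, rfl, fun y hy ↦ ContDiffAt.contDiffWithinAt ?_⟩
  have hy' : θ.symm y ∈ θ.source := θ.symm.map_source hy
  obtain ⟨L', hL'⟩ := hy'.2.2
  exact θ.contDiffAt_symm hy (hL' ▸ hderiv _ hy'.2.1) (hFat _ hy'.2.1)

variable {n : ℕ} {X : Type*} [TopologicalSpace X] [ChartedSpace (EuclideanSpace ℝ (Fin n)) X]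
  [IsManifold (𝓡 n) ∞ X]

theorem fderiv_comp_chartAt_symm_injective {f : X → EuclideanSpace ℝ (Fin n)} {x : X}
    (hf : MDifferentiableAt (𝓡 n) (𝓡 n) f x)
    (hinj : Function.Injective (mfderiv (𝓡 n) (𝓡 n) f x)) :
    Function.Injective
      (fderiv ℝ (f ∘ (chartAt (EuclideanSpace ℝ (Fin n)) x).symm) (chartAt _ x x)) := by
  have hc := mdifferentiable_chart (I := 𝓡 n) x
  have hx := mem_chart_source (EuclideanSpace ℝ (Fin n)) x
  have hxt := (chartAt (EuclideanSpace ℝ (Fin n)) x).map_source hx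
  rw [← (chartAt (EuclideanSpace ℝ (Fin n)) x).left_inv hx] at hf hinj
  rw [← mfderiv_eq_fderiv, mfderiv_comp _ hf (hc.mdifferentiableAt_symm hxt)]
  exact hinj.comp (hc.symm.mfderiv_injective hxt)

theorem exists_mem_maximalAtlas_of_mfderiv_injective {f : X → EuclideanSpace ℝ (Fin n)} {W : Set X}
    (hW : IsOpen W) (hf : ContMDiffOn (𝓡 n) (𝓡 n) ∞ f W) {x : X} (hx : x ∈ W)
    (hinj : Function.Injective (mfderiv (𝓡 n) (𝓡 n) f x)) :
    ∃ e ∈ IsManifold.maximalAtlas (𝓡 n) ∞ X, x ∈ e.source ∧ e.source ⊆ W ∧ EqOn e f e.source := by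
  set c := chartAt (EuclideanSpace ℝ (Fin n)) x
  have hc : c ∈ IsManifold.maximalAtlas (𝓡 n) ∞ X := IsManifold.chart_mem_maximalAtlas x
  have hxc : x ∈ c.source := mem_chart_source _ x
  have hxT : c x ∈ c.target ∩ c.symm ⁻¹' W := ⟨c.map_source hxc, by simpa [hxc] using hx⟩
  have hF : ContDiffOn ℝ ∞ (f ∘ c.symm) (c.target ∩ c.symm ⁻¹' W) :=
    contMDiffOn_iff_contDiffOn.1 <| hf.comp
      ((contMDiffOn_symm_of_mem_maximalAtlas hc).mono inter_subset_left) fun z hz ↦ hz.2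
  obtain ⟨θ, hxθ, hθT, hθF, hθsymm⟩ := exists_openPartialHomeomorph_of_fderiv_injective
    (c.symm.isOpen_inter_preimage hW) hF hxT (fderiv_comp_chartAt_symm_injective
      ((hf.contMDiffAt (hW.mem_nhds hx)).mdifferentiableAt (by simp)) hinj)
  have hef : EqOn (c.trans θ) f (c.trans θ).source := fun y hy ↦ by
    rw [OpenPartialHomeomorph.coe_trans, hθF, Function.comp_apply, Function.comp_apply,
      c.left_inv hy.1]
  have heW : (c.trans θ).source ⊆ W := fun y hy ↦ c.left_inv hy.1 ▸ (hθT hy.2).2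
  exact ⟨c.trans θ, OpenPartialHomeomorph.mem_maximalAtlas_of_contMDiffOn _
    ((hf.mono heW).congr hef)
    ((contMDiffOn_symm_of_mem_maximalAtlas hc).comp
      ((contMDiffOn_iff_contDiffOn.2 hθsymm).mono fun y hy ↦ hy.1) fun y hy ↦ hy.2),
    ⟨hxc, hxθ⟩, heW, hef⟩

end Charts

/-! ### Lorentzian scalar products -/

namespace IsLorentzian

variable {n : ℕ} {V : Type*} [AddCommGroup V] [Module ℝ V] [TopologicalSpace V]
  {b : V →L[ℝ] V →L[ℝ] ℝ}

theorem symm (h : IsLorentzian n b) (u v : V) : b u v = b v u := by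
  obtain ⟨e, he⟩ := h
  have hflip : b.toBilinForm = b.toBilinForm.flip := LinearMap.BilinForm.ext_basis e fun i j ↦ by
    rw [LinearMap.BilinForm.flip_apply, b.toBilinForm_apply, b.toBilinForm_apply, he, he]
    grind
  exact congrArg (· u v) hflip

theorem nondegenerate (h : IsLorentzian n b) : b.toBilinForm.Nondegenerate := by
  obtain ⟨e, he⟩ := h
  have hdiag : LinearMap.BilinForm.toMatrix e b.toBilinForm =
      Matrix.diagonal fun i : Fin n ↦ if (i : ℕ) = 0 then 1 else -1 := by
    ext i j
    rw [LinearMap.BilinForm.toMatrix_apply, b.toBilinForm_apply, he, Matrix.diagonal_apply]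
  rw [LinearMap.BilinForm.nondegenerate_iff_det_ne_zero e, hdiag, Matrix.det_diagonal,
    Finset.prod_ne_zero_iff]
  intro i _
  split_ifs <;> norm_num

theorem eq_zero (h : IsLorentzian n b) {u : V} (hu : ∀ v, b u v = 0) : u = 0 :=
  h.nondegenerate.1 u hu

theorem det_gram_ne_zero (h : IsLorentzian n b) {ν : Type*} [Fintype ν] [DecidableEq ν]
    (e : Module.Basis ν ℝ V) : (Matrix.of fun i j ↦ b (e i) (e j)).det ≠ 0 := by
  convert (LinearMap.BilinForm.nondegenerate_iff_det_ne_zero e).1 h.nondegenerate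
  ext i j
  rw [LinearMap.BilinForm.toMatrix_apply]
  rfl

end IsLorentzian

/-! ### Manifolds with boundary -/

section Boundary

variable {E : Type*} [NormedAddCommGroup E] [NormedSpace ℝ E]
  {K : Type*} [TopologicalSpace K] {I : ModelWithCorners ℝ E K}
  {M : Type*} [TopologicalSpace M] [ChartedSpace K M]

theorem dense_interior [FiniteDimensional ℝ E] [IsManifold I 1 M] : Dense (I.interior M) := by
  refine fun p ↦ mem_closure_iff_nhds.2 fun W hW ↦ ?_
  have hW' : (extChartAt I p).symm ⁻¹' W ∈ 𝓝 (extChartAt I p p) :=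
    (continuousAt_extChartAt_symm p).preimage_mem_nhds (by simpa using hW)
  obtain ⟨z, hzW, hz⟩ := mem_closure_iff_nhds.1
    (extChartAt_target_subset_closure_interior (mem_extChartAt_target (I := I) p)) _ hW'
  have hzt := interior_subset hz
  have hsrc : (extChartAt I p).symm z ∈ (chartAt K p).source := by
    simpa using (extChartAt I p).map_target hzt
  refine ⟨(extChartAt I p).symm z, hzW,
    (I.isInteriorPoint_iff_of_mem_atlas one_ne_zero (chart_mem_atlas K p) hsrc).2 ?_⟩
  rwa [show (chartAt K p).extend I ((extChartAt I p).symm z) = z from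
    (extChartAt I p).right_inv hzt]

theorem IsSmoothBilinField.contMDiffOn_apply [IsManifold I ∞ M] {b : BilinField I M}
    (hb : IsSmoothBilinField I b) {X Y : ∀ m : M, TangentSpace I m} {O : Set M}
    (hX : CMDiff[O] ∞ (T% X)) (hY : CMDiff[O] ∞ (T% Y)) :
    CMDiff[O] ∞ (fun m ↦ b m (X m) (Y m)) := by
  intro m hm
  have : ContMDiffWithinAt I (I.prod 𝓘(ℝ)) ∞
      (fun m ↦ Bundle.TotalSpace.mk' ℝ (E := Bundle.Trivial M ℝ) m (b m (X m) (Y m))) O m :=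
    ContMDiffWithinAt.clm_bundle_apply₂ (F₁ := E) (F₂ := E) hb.contMDiffAt.contMDiffWithinAt
      (hX m hm) (hY m hm)
  simp only [Bundle.contMDiffWithinAt_totalSpace] at this
  exact this.2

variable {n : ℕ} {H : Type*} [TopologicalSpace H] [ChartedSpace (EuclideanSpace ℝ (Fin n)) H]

theorem exists_contMDiffOn_comp_eq_domChart {ι : H → M} {p : H}
    (hι : IsImmersionAt (𝓡 n) I ∞ ι p) :
    ∃ P : M → EuclideanSpace ℝ (Fin n), ContMDiffOn I (𝓡 n) ∞ P hι.codChart.source ∧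
      ∀ x ∈ hι.domChart.source, P (ι x) = hι.domChart x := by
  refine ⟨fun m ↦ (hι.equiv.symm (hι.codChart.extend I m)).1, ?_, fun x hx ↦ ?_⟩
  · exact ContMDiff.comp_contMDiffOn (g := fun y : E ↦ (hι.equiv.symm y).1)
      (contMDiff_iff_contDiff.2 (contDiff_fst.comp hι.equiv.symm.contDiff))
      (hι.codChart.contMDiffOn_extend hι.codChart_mem_maximalAtlas)
  · have hx' : hι.domChart.extend (𝓡 n) x ∈ (hι.domChart.extend (𝓡 n)).target := by
      simpa using hι.domChart.map_source hx
    have hcharts := hι.writtenInCharts hx'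
    simp only [Function.comp_apply, hι.domChart.extend_left_inv hx] at hcharts
    change (hι.equiv.symm (hι.codChart.extend I (ι x))).1 = _
    rw [hcharts, hι.equiv.symm_apply_apply]
    rfl

theorem exists_contMDiffOn_comp_eq_self [IsManifold (𝓡 n) ∞ H] {ι : H → M}
    {e : OpenPartialHomeomorph H (EuclideanSpace ℝ (Fin n))}
    (he : e ∈ IsManifold.maximalAtlas (𝓡 n) ∞ H) {z : EuclideanSpace ℝ (Fin n)}
    (hz : z ∈ e.target) (hι : IsImmersionAt (𝓡 n) I ∞ ι (e.symm z)) :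
    ∃ (O : Set M) (π : M → EuclideanSpace ℝ (Fin n)), IsOpen O ∧ ι (e.symm z) ∈ O ∧
      ContMDiffOn I (𝓡 n) ∞ π O ∧ ∀ᶠ y in 𝓝 z, π (ι (e.symm y)) = y := by
  obtain ⟨P, hP, hPι⟩ := exists_contMDiffOn_comp_eq_domChart hι
  set d := hι.domChart
  have hzd : e.symm z ∈ d.source := hι.mem_domChart_source
  have hD : IsOpen (d.target ∩ d.symm ⁻¹' e.source) := d.symm.isOpen_inter_preimage e.open_source
  refine ⟨_, fun m ↦ e (d.symm (P m)),
    hP.continuousOn.isOpen_inter_preimage hι.codChart.open_source hD,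
    ⟨hι.mem_codChart_source, ?_⟩, ?_, ?_⟩
  · rw [mem_preimage, hPι _ hzd]
    exact ⟨d.map_source hzd, by
      simpa only [mem_preimage, d.left_inv hzd] using e.map_target hz⟩
  · exact (contMDiffOn_of_mem_maximalAtlas he).comp
      ((contMDiffOn_symm_of_mem_maximalAtlas hι.domChart_mem_maximalAtlas).comp
        (hP.mono inter_subset_left) fun m hm ↦ hm.2.1) fun m hm ↦ hm.2.2
  · filter_upwards [(e.continuousAt_symm hz).eventually (d.open_source.mem_nhds hzd),
      e.open_target.mem_nhds hz] with y hyd hye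
    rw [hPι _ hyd, d.left_inv hyd, e.right_inv hye]

end Boundary

section CoordinateChart

variable {n : ℕ} {X : Type*} [TopologicalSpace X] [ChartedSpace (EuclideanSpace ℝ (Fin n)) X]
  {E : Type*} [NormedAddCommGroup E] [NormedSpace ℝ E]
  {K : Type*} [TopologicalSpace K] {I : ModelWithCorners ℝ E K}
  {M : Type*} [TopologicalSpace M] [ChartedSpace K M] [IsManifold I ∞ M]
  {t : Fin n → M → ℝ} {fr : Fin n → ∀ m : M, TangentSpace I m} {O : Set M} {Ψ : X → M}

theorem mdifferentiableAt_symm_of_mem_maximalAtlas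
    {e : OpenPartialHomeomorph X (EuclideanSpace ℝ (Fin n))}
    (he : e ∈ IsManifold.maximalAtlas (𝓡 n) ∞ X) {z : EuclideanSpace ℝ (Fin n)}
    (hz : z ∈ e.target) : MDifferentiableAt (𝓡 n) (𝓡 n) e.symm z :=
  (contMDiffAt_symm_of_mem_maximalAtlas he hz).mdifferentiableAt (by simp)

namespace IsCoordinateFrame

theorem contMDiffOn_coordinates_comp (h : IsCoordinateFrame t fr O)
    (hΨ : ContMDiff (𝓡 n) I ∞ Ψ) :
    ContMDiffOn (𝓡 n) (𝓡 n) ∞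
      (fun x ↦ (WithLp.toLp 2 fun a ↦ t a (Ψ x) : EuclideanSpace ℝ (Fin n))) (Ψ ⁻¹' O) :=
  (contMDiff_iff_contDiff.2 (EuclideanSpace.equiv (Fin n) ℝ).symm.contDiff).comp_contMDiffOn
    (contMDiffOn_pi_space.2 fun a ↦ (h.contMDiffOn_coord a).comp hΨ.contMDiffOn fun _ hx ↦ hx)

theorem mfderiv_coordinates_comp_injective (h : IsCoordinateFrame t fr O)
    (hΨ : ContMDiff (𝓡 n) I ∞ Ψ) {x : X} (hx : Ψ x ∈ O)
    (hinj : Function.Injective (mfderiv (𝓡 n) I Ψ x)) :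
    Function.Injective (mfderiv (𝓡 n) (𝓡 n)
      (fun x ↦ (WithLp.toLp 2 fun a ↦ t a (Ψ x) : EuclideanSpace ℝ (Fin n))) x) := by
  refine (injective_iff_map_eq_zero _).2 fun u hu ↦ (injective_iff_map_eq_zero _).1 hinj u
    (h.eq_zero _ hx _ fun b ↦ ?_)
  have hf := ((h.contMDiffOn_coordinates_comp hΨ).contMDiffAt
    ((h.isOpen.preimage hΨ.continuous).mem_nhds hx)).mdifferentiableAt (n := ∞) (by simp)
  have hproj : MDifferentiableAt (𝓡 n) 𝓘(ℝ, ℝ) (fun y : EuclideanSpace ℝ (Fin n) ↦ y b)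
      (WithLp.toLp 2 fun a ↦ t a (Ψ x)) :=
    (EuclideanSpace.proj b : EuclideanSpace ℝ (Fin n) →L[ℝ] ℝ).mdifferentiableAt
  calc differential I (t b) (Ψ x) (mfderiv (𝓡 n) I Ψ x u)
      = differential (𝓡 n) (fun x ↦ t b (Ψ x)) x u :=
        (differential_comp_apply (h.mdifferentiableAt_coord hx b)
          (hΨ.mdifferentiableAt (by simp)) u).symm
    _ = 0 := (differential_comp_apply
        (σ := fun x ↦ WithLp.toLp 2 fun a ↦ t a (Ψ x)) hproj hf u).trans
        ((congrArg _ hu).trans (map_zero _))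

theorem exists_isAdaptedAt_chart [IsManifold (𝓡 n) ∞ X] (h : IsCoordinateFrame t fr O)
    (hΨ : ContMDiff (𝓡 n) I ∞ Ψ) {x : X} (hx : Ψ x ∈ O)
    (hinj : Function.Injective (mfderiv (𝓡 n) I Ψ x)) :
    ∃ e ∈ IsManifold.maximalAtlas (𝓡 n) ∞ X, x ∈ e.source ∧
      ∀ z ∈ e.target, Ψ (e.symm z) ∈ O ∧ IsAdaptedAt fr (fun y ↦ Ψ (e.symm y)) z := by
  obtain ⟨e, he, hxe, heO, hcoord⟩ := exists_mem_maximalAtlas_of_mfderiv_injective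
    (h.isOpen.preimage hΨ.continuous) (h.contMDiffOn_coordinates_comp hΨ) hx
    (h.mfderiv_coordinates_comp_injective hΨ hx hinj)
  refine ⟨e, he, hxe, fun z hz ↦ ⟨heO (e.map_target hz), ?_⟩⟩
  refine h.isAdaptedAt (τ := id) (heO (e.map_target hz))
    ((hΨ.mdifferentiableAt (by simp)).comp z
      (mdifferentiableAt_symm_of_mem_maximalAtlas he hz)) fun a b ↦ ?_
  rw [id, ← partialDeriv_coord a b z]
  refine partialDeriv_congr ?_ a
  filter_upwards [e.open_target.mem_nhds hz] with y hy
  have hy' := hcoord (e.map_target hy)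
  rw [e.right_inv hy] at hy'
  exact (congrArg (fun v : EuclideanSpace ℝ (Fin n) ↦ v b) hy').symm

end IsCoordinateFrame

end CoordinateChart

section Components

variable {n : ℕ} {E : Type*} [NormedAddCommGroup E] [NormedSpace ℝ E]
  {K : Type*} [TopologicalSpace K] {I : ModelWithCorners ℝ E K}
  {M : Type*} [TopologicalSpace M] [ChartedSpace K M]

theorem ricci_eq_frameRicci [IsManifold I ∞ M] {fr : Fin n → ∀ m : M, TangentSpace I m}
    {G : M → Matrix (Fin n) (Fin n) ℝ} {O : Set M} (hO : IsOpen O)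
    (hfr : ∀ a, CMDiff[O] ∞ (T% (fr a))) (hG : ∀ i j, CMDiff[O] ∞ (fun m ↦ G m i j))
    (hdet : ∀ m ∈ O, (G m).det ≠ 0)
    {G' : EuclideanSpace ℝ (Fin n) → Matrix (Fin n) (Fin n) ℝ}
    {σ : EuclideanSpace ℝ (Fin n) → M} {U : Set (EuclideanSpace ℝ (Fin n))} (hU : IsOpen U)
    (hσO : MapsTo σ U O) (hσ : ∀ z ∈ U, IsAdaptedAt fr σ z) (hG' : EqOn G' (G ∘ σ) U)
    {z : EuclideanSpace ℝ (Fin n)} (hz : z ∈ U) (d b : Fin n) :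
    ricci G' d b z = frameRicci fr (frameChristoffel fr G) d b (σ z) := by
  have hΓ : ∀ k i j, CMDiff[O] ∞ (frameChristoffel fr G k i j) := fun k i j ↦
    contMDiffOn_finsetSum fun l _ ↦ (contMDiffOn_matrix_inv hG hdet k l).mul
      (contMDiffOn_frameChristoffelFirst hO hfr hG i j l)
  have hdiff : ∀ {f : M → ℝ}, CMDiff[O] ∞ f → ∀ y ∈ U, MDiffAt f (σ y) := fun hf y hy ↦
    (hf.contMDiffAt (hO.mem_nhds (hσO hy))).mdifferentiableAt (by simp)
  refine (hσ z hz).ricci_eq (fun k i j ↦ hdiff (hΓ k i j) z hz) (fun k i j ↦ ?_) d b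
  filter_upwards [hU.mem_nhds hz] with y hy
  exact (hσ y hy).christoffel_eq (fun i j ↦ hdiff (hG i j) y hy)
    (hG'.eventuallyEq_of_mem (hU.mem_nhds hy)) k i j

/-- The components `b(X_i, X_j)` of the bilinear form field `b` in the frame `X`. -/
def frameComponents {ν : Type*} (X : ν → ∀ m : M, TangentSpace I m) (b : BilinField I M) (m : M) :
    Matrix ν ν ℝ :=
  Matrix.of fun i j ↦ b m (X i m) (X j m)

variable {H : Type*} [TopologicalSpace H] [ChartedSpace (EuclideanSpace ℝ (Fin n)) H]
  {e : OpenPartialHomeomorph H (EuclideanSpace ℝ (Fin n))} {z : EuclideanSpace ℝ (Fin n)}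

theorem mfderiv_comp_symm_single {f : H → M} (he : e ∈ IsManifold.maximalAtlas (𝓡 n) ∞ H)
    (hz : z ∈ e.target) (hf : MDifferentiableAt (𝓡 n) I f (e.symm z)) (i : Fin n) :
    mfderiv (𝓡 n) I (fun y ↦ f (e.symm y)) z (EuclideanSpace.single i 1) =
      mfderiv (𝓡 n) I f (e.symm z)
        (mfderiv (𝓡 n) (𝓡 n) e.symm z (EuclideanSpace.single i 1)) :=
  mfderiv_comp_apply z hf (mdifferentiableAt_symm_of_mem_maximalAtlas he hz) _

theorem components_pullback {f : H → M} (he : e ∈ IsManifold.maximalAtlas (𝓡 n) ∞ H)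
    (hz : z ∈ e.target) (hf : MDifferentiableAt (𝓡 n) I f (e.symm z))
    {X : Fin n → ∀ m : M, TangentSpace I m} (hX : IsAdaptedAt X (fun y ↦ f (e.symm y)) z)
    (b : BilinField I M) :
    components (pullback I (𝓡 n) f b) e z = frameComponents X b (f (e.symm z)) := by
  have hframe := fun i ↦ (mfderiv_comp_symm_single he hz hf i).symm.trans (hX.mfderiv_single i)
  ext i j
  exact congrArg₂ (fun u v ↦ b (f (e.symm z)) u v) (hframe i) (hframe j)

theorem det_components_ne_zero {g : BilinField (𝓡 n) H}
    (he : e ∈ IsManifold.maximalAtlas (𝓡 n) ∞ H) (hz : z ∈ e.target)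
    (hg : IsLorentzian n (g (e.symm z))) : (components g e z).det ≠ 0 := by
  have hbij : Function.Bijective (mfderiv (𝓡 n) (𝓡 n) e.symm z) :=
    OpenPartialHomeomorph.MDifferentiable.mfderiv_bijective (x := z)
      ⟨(contMDiffOn_symm_of_mem_maximalAtlas he).mdifferentiableOn (by simp),
        (contMDiffOn_of_mem_maximalAtlas he).mdifferentiableOn (by simp)⟩ hz
  let L : EuclideanSpace ℝ (Fin n) ≃ₗ[ℝ] TangentSpace (𝓡 n) (e.symm z) :=
    LinearEquiv.ofBijective (mfderiv (𝓡 n) (𝓡 n) e.symm z).toLinearMap hbij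
  have hL : ∀ i, (EuclideanSpace.basisFun (Fin n) ℝ).toBasis.map L i =
      mfderiv (𝓡 n) (𝓡 n) e.symm z (EuclideanSpace.single i 1) := fun i ↦ congrArg L (by simp)
  simpa only [components, hL] using
    hg.det_gram_ne_zero ((EuclideanSpace.basisFun (Fin n) ℝ).toBasis.map L)

end Components

theorem eq_zero_of_forall_dual_eq_zero {𝕜 V : Type*} [Field 𝕜] [AddCommGroup V] [Module 𝕜 V]
    {n : ℕ} (hV : Module.finrank 𝕜 V = n + 1) {t : Fin (n + 1) → Module.Dual 𝕜 V} (h0 : t 0 ≠ 0)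
    {u : Fin n → V} (htu : ∀ i b, t b (u i) = if b = i.succ then 1 else 0) {v : V}
    (hv : ∀ b, t b v = 0) : v = 0 := by
  have : Module.Finite 𝕜 V := Module.finite_of_finrank_pos (by omega)
  have hind : LinearIndependent 𝕜 t := by
    refine Fintype.linearIndependent_iff.2 fun c hc ↦ ?_
    have hsucc : ∀ i : Fin n, c i.succ = 0 := fun i ↦ by
      simpa [htu] using LinearMap.congr_fun hc (u i)
    refine Fin.cases ?_ hsucc
    simpa [Fin.sum_univ_succ, hsucc, h0] using hc
  have hspan : Submodule.span 𝕜 (range t) = ⊤ :=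
    hind.span_eq_top_of_card_eq_finrank' (by rw [Subspace.dual_finrank_eq, hV, Fintype.card_fin])
  refine (Module.forall_dual_apply_eq_zero_iff 𝕜 v).1 fun φ ↦ ?_
  have hφ : φ ∈ Submodule.span 𝕜 (range t) := hspan ▸ Submodule.mem_top
  induction hφ using Submodule.span_induction with
  | mem φ hφ => obtain ⟨b, rfl⟩ := hφ; exact hv b
  | zero => rfl
  | add φ ψ _ _ hφ hψ => rw [LinearMap.add_apply, hφ, hψ, add_zero]
  | smul c φ _ hφ => rw [LinearMap.smul_apply, hφ, smul_zero]

/-! ### Asymptotes -/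

section Asymptote

variable {X M H : Type*}
  [TopologicalSpace X] [ChartedSpace (EuclideanSpace ℝ (Fin 4)) X]
  [TopologicalSpace M] [ChartedSpace (EuclideanHalfSpace 4) M] [IsManifold (𝓡∂ 4) ∞ M]

theorem contMDiff_coe_diffeomorph (Φ : X ≃ₘ^∞⟮𝓡 4, 𝓡∂ 4⟯ (interiorOpens M)) :
    ContMDiff (𝓡 4) (𝓡∂ 4) ∞ (fun x : X ↦ (Φ x : M)) :=
  contMDiff_subtype_val.comp Φ.contMDiff

variable [IsManifold (𝓡 4) ∞ X]
  [TopologicalSpace H] [ChartedSpace (EuclideanSpace ℝ (Fin 3)) H] [IsManifold (𝓡 3) ∞ H]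
  {g : BilinField (𝓡 4) X} {Φ : X ≃ₘ^∞⟮𝓡 4, 𝓡∂ 4⟯ (interiorOpens M)} {ι : H → M}
  {Ω : M → ℝ} {q : BilinField (𝓡∂ 4) M} {N : ∀ p : M, TangentSpace (𝓡∂ 4) p}

namespace IsAsymptote

theorem mdifferentiableAt_Ω (h : IsAsymptote g Φ ι Ω q N) (m : M) :
    MDifferentiableAt (𝓡∂ 4) 𝓘(ℝ, ℝ) Ω m :=
  h.Ω_smooth.mdifferentiableAt (by simp)

theorem mdifferentiableAt_ι (h : IsAsymptote g Φ ι Ω q N) (p : H) :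
    MDifferentiableAt (𝓡 3) (𝓡∂ 4) ι p :=
  h.ι_embedding.contMDiff.mdifferentiableAt (by simp)

theorem exists_coe_eq (h : IsAsymptote g Φ ι Ω q N) {m : M} (hm : Ω m ≠ 0) :
    ∃ x : X, (Φ x : M) = m := by
  have hint : m ∈ (𝓡∂ 4).interior M := by
    rw [← ModelWithCorners.compl_boundary, ← h.range_ι]
    rintro ⟨p, rfl⟩
    exact hm (h.Ω_eq_zero p)
  obtain ⟨x, hx⟩ := Φ.surjective ⟨m, hint⟩
  exact ⟨x, congrArg Subtype.val hx⟩

theorem dense_Ω_ne_zero (h : IsAsymptote g Φ ι Ω q N) : Dense {m | Ω m ≠ 0} := by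
  have : IsManifold (𝓡∂ 4) 1 M := .of_le (n := ∞) (by simp)
  refine (dense_interior (I := 𝓡∂ 4) (M := M)).mono fun m hm ↦ ?_
  obtain ⟨x, hx⟩ := Φ.surjective ⟨m, hm⟩
  exact (congrArg (fun y : interiorOpens M ↦ Ω y) hx).symm.trans_ne (h.Ω_ne_zero x)

theorem differential_Ω_coe (h : IsAsymptote g Φ ι Ω q N) (x : X) (u : TangentSpace (𝓡 4) x) :
    differential (𝓡 4) (fun x : X ↦ Ω (Φ x)) x u =
      differential (𝓡∂ 4) Ω (Φ x) (mfderiv (𝓡 4) (𝓡∂ 4) (fun x : X ↦ (Φ x : M)) x u) :=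
  differential_comp_apply (h.mdifferentiableAt_Ω _)
    ((contMDiff_coe_diffeomorph Φ).mdifferentiableAt (by simp)) u

theorem q_mfderiv (h : IsAsymptote g Φ ι Ω q N) (x : X) (u v : TangentSpace (𝓡 4) x) :
    q (Φ x) (mfderiv (𝓡 4) (𝓡∂ 4) (fun x : X ↦ (Φ x : M)) x u)
        (mfderiv (𝓡 4) (𝓡∂ 4) (fun x : X ↦ (Φ x : M)) x v) =
      Ω (Φ x) ^ 2 * (g x u v + (Ω (Φ x) ^ 4)⁻¹ *
        (differential (𝓡 4) (fun x : X ↦ Ω (Φ x)) x u *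
          differential (𝓡 4) (fun x : X ↦ Ω (Φ x)) x v)) :=
  h.q_eq x u v

theorem physical_eq (h : IsAsymptote g Φ ι Ω q N) (x : X) (u v : TangentSpace (𝓡 4) x) :
    g x u v = (Ω (Φ x) ^ 2)⁻¹ * pullback (𝓡∂ 4) (𝓡 4) (fun x : X ↦ (Φ x : M)) q x u v -
      (Ω (Φ x) ^ 4)⁻¹ * (differential (𝓡 4) (fun x : X ↦ Ω (Φ x)) x u *
        differential (𝓡 4) (fun x : X ↦ Ω (Φ x)) x v) := by
  rw [h.q_eq, inv_mul_cancel_left₀ (pow_ne_zero 2 (h.Ω_ne_zero x)), add_sub_cancel_right]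

theorem mfderiv_coe_injective (h : IsAsymptote g Φ ι Ω q N) (x : X) :
    Function.Injective (mfderiv (𝓡 4) (𝓡∂ 4) (fun x : X ↦ (Φ x : M)) x) := by
  refine (injective_iff_map_eq_zero _).2 fun u hu ↦
    (h.vacuum.lorentzian x).eq_zero fun v ↦ ?_
  rw [h.physical_eq, pullback_apply, h.differential_Ω_coe x u, hu]
  simp

theorem mfderiv_coe_surjective (h : IsAsymptote g Φ ι Ω q N) (x : X) :
    Function.Surjective (mfderiv (𝓡 4) (𝓡∂ 4) (fun x : X ↦ (Φ x : M)) x) := by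
  let L : EuclideanSpace ℝ (Fin 4) →ₗ[ℝ] EuclideanSpace ℝ (Fin 4) :=
    (mfderiv (𝓡 4) (𝓡∂ 4) (fun x : X ↦ (Φ x : M)) x).toLinearMap
  exact (LinearMap.injective_iff_surjective (f := L)).1 (h.mfderiv_coe_injective x)

theorem q_symm (h : IsAsymptote g Φ ι Ω q N) {m : M} (hm : Ω m ≠ 0)
    (u v : TangentSpace (𝓡∂ 4) m) : q m u v = q m v u := by
  obtain ⟨x, rfl⟩ := h.exists_coe_eq hm
  obtain ⟨u, rfl⟩ := h.mfderiv_coe_surjective x u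
  obtain ⟨v, rfl⟩ := h.mfderiv_coe_surjective x v
  rw [h.q_mfderiv, h.q_mfderiv, (h.vacuum.lorentzian x).symm u v,
    mul_comm (differential _ _ x u)]

theorem sq_mul_q_normal (h : IsAsymptote g Φ ι Ω q N) {m : M} (hm : Ω m ≠ 0)
    (v : TangentSpace (𝓡∂ 4) m) :
    Ω m ^ 2 * q m v (N m) = (1 + digamma Ω N m) * differential (𝓡∂ 4) Ω m v := by
  obtain ⟨x, rfl⟩ := h.exists_coe_eq hm
  obtain ⟨v, rfl⟩ := h.mfderiv_coe_surjective x v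
  obtain ⟨n, hn, hN⟩ := h.N_eq x
  rw [digamma, hN, h.q_mfderiv, (h.vacuum.lorentzian x).symm v n, hn,
    h.differential_Ω_coe, h.differential_Ω_coe]
  field_simp

section BoundaryCoordinates

variable {e : OpenPartialHomeomorph H (EuclideanSpace ℝ (Fin 3))} {z : EuclideanSpace ℝ (Fin 3)}
  {s : Fin 3 → M → ℝ}

theorem partialDeriv_coordinates (h : IsAsymptote g Φ ι Ω q N)
    (hs : ∀ᶠ y in 𝓝 z, ∀ i, s i (ι (e.symm y)) = y i) (a : Fin 3) (b : Fin 4) :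
    partialDeriv a (fun y ↦ (Fin.cons Ω s : Fin 4 → M → ℝ) b (ι (e.symm y))) z =
      if b = a.succ then 1 else 0 := by
  cases b using Fin.cases with
  | zero => simp [h.Ω_eq_zero, partialDeriv, (Fin.succ_ne_zero a).symm]
  | succ i =>
    simp only [Fin.cons_succ, Fin.succ_inj]
    exact (partialDeriv_congr (hs.mono fun y hy ↦ hy i) a).trans (partialDeriv_coord a i z)

theorem exists_adaptedFrame (h : IsAsymptote g Φ ι Ω q N)
    (he : e ∈ IsManifold.maximalAtlas (𝓡 3) ∞ H) (hz : z ∈ e.target) :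
    ∃ (s : Fin 3 → M → ℝ) (fr : Fin 4 → ∀ m : M, TangentSpace (𝓡∂ 4) m) (O : Set M),
      ι (e.symm z) ∈ O ∧ IsCoordinateFrame (Fin.cons Ω s) fr O ∧
        ∀ᶠ y in 𝓝 z, IsAdaptedAt (fun i : Fin 3 ↦ fr i.succ) (fun y ↦ ι (e.symm y)) y := by
  obtain ⟨O, π, hO, hp, hπ, hπι⟩ := exists_contMDiffOn_comp_eq_self he hz
    (h.ι_embedding.isImmersion.isImmersionAt (e.symm z))
  let s : Fin 3 → M → ℝ := fun i m ↦ π m i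
  have hs : ∀ᶠ y in 𝓝 z, ∀ i, s i (ι (e.symm y)) = y i := hπι.mono fun y hy i ↦ congrArg (· i) hy
  have hsmooth : ∀ a, ContMDiffOn (𝓡∂ 4) 𝓘(ℝ, ℝ) ∞ ((Fin.cons Ω s : Fin 4 → M → ℝ) a) O :=
    Fin.cases h.Ω_smooth.contMDiffOn fun i ↦
      (EuclideanSpace.proj i : EuclideanSpace ℝ (Fin 3) →L[ℝ] ℝ).contMDiff.comp_contMDiffOn hπ
  have hσ : ∀ y ∈ e.target, MDifferentiableAt (𝓡 3) (𝓡∂ 4) (fun y ↦ ι (e.symm y)) y :=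
    fun y hy ↦ (h.mdifferentiableAt_ι _).comp y (mdifferentiableAt_symm_of_mem_maximalAtlas he hy)
  have hcoord : ∀ i b, differential (𝓡∂ 4) ((Fin.cons Ω s : Fin 4 → M → ℝ) b) (ι (e.symm z))
      (mfderiv (𝓡 3) (𝓡∂ 4) (fun y ↦ ι (e.symm y)) z (EuclideanSpace.single i 1)) =
        if b = i.succ then 1 else 0 := fun i b ↦
    (differential_comp_apply (σ := fun y ↦ ι (e.symm y)) (((hsmooth b).contMDiffAt
      (hO.mem_nhds hp)).mdifferentiableAt (by simp)) (hσ z hz) _).symm.trans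
      ((partialDeriv_eq_differential i _ z).symm.trans (h.partialDeriv_coordinates hs i b))
  have hinj : ∀ v : TangentSpace (𝓡∂ 4) (ι (e.symm z)),
      (∀ a, differential (𝓡∂ 4) ((Fin.cons Ω s : Fin 4 → M → ℝ) a) _ v = 0) → v = 0 :=
    fun v hv ↦ eq_zero_of_forall_dual_eq_zero (V := EuclideanSpace ℝ (Fin 4)) (𝕜 := ℝ) (n := 3)
      (t := fun a ↦ (differential (𝓡∂ 4) ((Fin.cons Ω s : Fin 4 → M → ℝ) a) _).toLinearMap)
      finrank_euclideanSpace_fin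
      (fun h0 ↦ h.dΩ_ne_zero _ (ContinuousLinearMap.coe_injective h0)) hcoord hv
  obtain ⟨fr, O', hp', hfr⟩ := exists_isCoordinateFrame
    (EuclideanSpace.basisFun (Fin 4) ℝ).toBasis hO hp hsmooth hinj
  refine ⟨s, fr, O', hp', hfr, ?_⟩
  filter_upwards [hs.eventually_nhds, e.open_target.mem_nhds hz,
    (hσ z hz).continuousAt.eventually (hfr.isOpen.mem_nhds hp')] with y hy hye hyO
  exact hfr.isAdaptedAt hyO (hσ y hye) (h.partialDeriv_coordinates hy)

end BoundaryCoordinates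

variable {s : Fin 3 → M → ℝ} {fr : Fin 4 → ∀ m : M, TangentSpace (𝓡∂ 4) m} {O : Set M}

theorem digamma_eq_neg_one_of_mem {p : H} (h : IsAsymptote g Φ ι Ω q N)
    (hfr : IsCoordinateFrame (Fin.cons Ω s) fr O) (hp : ι p ∈ O) : digamma Ω N (ι p) = -1 := by
  have hlimit : EqOn (fun m ↦ Ω m ^ 2 * q m (fr 0 m) (N m)) (fun m ↦ 1 + digamma Ω N m) O := by
    refine eqOn_of_eqOn_inter_dense h.dense_Ω_ne_zero hfr.isOpen
      ((h.Ω_smooth.continuous.pow 2).continuousOn.mul (h.q_smooth.contMDiffOn_apply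
        (hfr.contMDiffOn_frame 0) (ContMDiff.contMDiffOn h.N_smooth)).continuousOn)
      (continuousOn_const.add (contMDiffOn_frameDeriv hfr.isOpen
        (ContMDiff.contMDiffOn h.N_smooth) h.Ω_smooth.contMDiffOn).continuousOn)
      fun m ⟨hm, hΩ⟩ ↦ ?_
    refine (h.sq_mul_q_normal hΩ _).trans ?_
    rw [show differential (𝓡∂ 4) Ω m (fr 0 m) = 1 from hfr.frameDeriv_coord m hm 0 0, mul_one]
  have hp' := hlimit hp
  simp only [h.Ω_eq_zero] at hp'
  linarith

theorem exists_isCollarFrame {p : H} (h : IsAsymptote g Φ ι Ω q N)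
    (hfr : IsCoordinateFrame (Fin.cons Ω s) fr O) (hp : ι p ∈ O)
    (hdet : (frameComponents (fun i : Fin 3 ↦ fr i.succ) q (ι p)).det ≠ 0) :
    ∃ O', ι p ∈ O' ∧ IsCoordinateFrame (Fin.cons Ω s) fr O' ∧
      IsCollarFrame fr Ω (frameComponents fr q) O' := by
  have hq : ∀ i j, ContMDiffOn (𝓡∂ 4) 𝓘(ℝ, ℝ) ∞ (fun m ↦ frameComponents fr q m i j) O :=
    fun i j ↦ h.q_smooth.contMDiffOn_apply (hfr.contMDiffOn_frame i) (hfr.contMDiffOn_frame j)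
  have hsymm : ∀ i j, EqOn (fun m ↦ frameComponents fr q m i j)
      (fun m ↦ frameComponents fr q m j i) O := fun i j ↦
    eqOn_of_eqOn_inter_dense h.dense_Ω_ne_zero hfr.isOpen (hq i j).continuousOn
      (hq j i).continuousOn fun m hm ↦ h.q_symm hm.2 _ _
  set D : M → ℝ := fun m ↦ (scaledMetric (Ω m) (frameComponents fr q m)).det
  have hD : ContinuousOn D O := (contMDiffOn_matrix_det
    (contMDiffOn_scaledMetric h.Ω_smooth.contMDiffOn hq)).continuousOn
  have hDp : D (ι p) ≠ 0 := by
    simp only [D, h.Ω_eq_zero, det_scaledMetric_zero]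
    exact neg_ne_zero.2 hdet
  have hfr' : IsCoordinateFrame (Fin.cons Ω s) fr (O ∩ D ⁻¹' {0}ᶜ) :=
    hfr.mono (hD.isOpen_inter_preimage hfr.isOpen isOpen_compl_singleton) inter_subset_left
  exact ⟨O ∩ D ⁻¹' {0}ᶜ, ⟨hp, hDp⟩, hfr',
    { isOpen := hfr'.isOpen
      contMDiffOn_frame := hfr'.contMDiffOn_frame
      contMDiffOn_w := h.Ω_smooth.contMDiffOn
      contMDiffOn_q := fun i j ↦ (hq i j).mono inter_subset_left
      frameDeriv_w := fun m hm a ↦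
        (hfr'.frameDeriv_coord m hm a 0).trans (if_congr eq_comm rfl rfl)
      isSymm_q := fun m hm ↦ Matrix.IsSymm.ext fun i j ↦ hsymm j i hm.1
      det_scaledMetric_ne_zero := fun m hm ↦ hm.2 }⟩

theorem components_eq_physicalMetric (h : IsAsymptote g Φ ι Ω q N)
    {e : OpenPartialHomeomorph X (EuclideanSpace ℝ (Fin 4))}
    (he : e ∈ IsManifold.maximalAtlas (𝓡 4) ∞ X) {z : EuclideanSpace ℝ (Fin 4)}
    (hz : z ∈ e.target) (hdΩ : ∀ i, frameDeriv (fr i) Ω (Φ (e.symm z)) = if i = 0 then 1 else 0)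
    (hfr : IsAdaptedAt fr (fun y ↦ (Φ (e.symm y) : M)) z) :
    components g e z =
      physicalMetric (Ω (Φ (e.symm z))) (frameComponents fr q (Φ (e.symm z))) := by
  have hΦ : MDifferentiableAt (𝓡 4) (𝓡∂ 4) (fun x ↦ (Φ x : M)) (e.symm z) :=
    (contMDiff_coe_diffeomorph Φ).mdifferentiableAt (by simp)
  have hdiff : ∀ i, differential (𝓡 4) (fun x : X ↦ Ω (Φ x)) (e.symm z)
      (mfderiv (𝓡 4) (𝓡 4) e.symm z (EuclideanSpace.single i 1)) = if i = 0 then 1 else 0 :=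
    fun i ↦ (h.differential_Ω_coe _ _).trans ((congrArg (differential (𝓡∂ 4) Ω _)
      ((mfderiv_comp_symm_single he hz hΦ i).symm.trans (hfr.mfderiv_single i))).trans (hdΩ i))
  ext i j
  rw [physicalMetric_apply, ← components_pullback he hz hΦ hfr]
  refine (h.physical_eq _ _ _).trans ?_
  simp only [hdiff, Matrix.single_apply, components, Matrix.of_apply, ite_and, mul_ite, mul_one,
    mul_zero, eq_comm (a := (0 : Fin 4))]
  split_ifs <;> rfl

theorem frameRicci_physicalMetric_eq_zero (h : IsAsymptote g Φ ι Ω q N)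
    (hfr : IsCoordinateFrame (Fin.cons Ω s) fr O)
    (hcollar : IsCollarFrame fr Ω (frameComponents fr q) O) {m : M} (hm : m ∈ O) (hΩ : Ω m ≠ 0)
    (d b : Fin 4) :
    frameRicci fr (frameChristoffel fr fun m ↦ physicalMetric (Ω m) (frameComponents fr q m))
      d b m = 0 := by
  obtain ⟨x, rfl⟩ := h.exists_coe_eq hΩ
  obtain ⟨e, he, hx, hadapted⟩ := hfr.exists_isAdaptedAt_chart (contMDiff_coe_diffeomorph Φ)
    hm (h.mfderiv_coe_injective x)
  have hΩO : ContMDiffOn (𝓡∂ 4) 𝓘(ℝ, ℝ) ∞ Ω (O ∩ {m | Ω m ≠ 0}) := h.Ω_smooth.contMDiffOn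
  have hric := ricci_eq_frameRicci (G' := components g e) (U := e.target) (z := e x)
    (σ := fun y ↦ (Φ (e.symm y) : M))
    (G := fun m ↦ physicalMetric (Ω m) (frameComponents fr q m))
    (hcollar.isOpen.inter (isOpen_ne_fun h.Ω_smooth.continuous continuous_const))
    (fun a ↦ (hcollar.contMDiffOn_frame a).mono inter_subset_left)
    (contMDiffOn_physicalMetric hΩO (fun m hm ↦ hm.2)
      fun i j ↦ (hcollar.contMDiffOn_q i j).mono inter_subset_left)
    (fun m hm ↦ det_physicalMetric_ne_zero hm.2 (hcollar.det_scaledMetric_ne_zero m hm.1))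
    e.open_target (fun z hz ↦ ⟨(hadapted z hz).1, h.Ω_ne_zero _⟩) (fun z hz ↦ (hadapted z hz).2)
    (fun z hz ↦ h.components_eq_physicalMetric he hz
      (hcollar.frameDeriv_w _ (hadapted z hz).1) (hadapted z hz).2) (e.map_source hx) d b
  rw [e.left_inv hx] at hric
  exact hric.symm.trans ((h.vacuum.ricci_eq_zero e he _ (e.map_source hx) d b).trans (zero_mul _))

section Boundary

variable {e : OpenPartialHomeomorph H (EuclideanSpace ℝ (Fin 3))} {z : EuclideanSpace ℝ (Fin 3)}

theorem eventually_components_eq_frameComponents (h : IsAsymptote g Φ ι Ω q N)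
    (he : e ∈ IsManifold.maximalAtlas (𝓡 3) ∞ H) (hz : z ∈ e.target)
    {Y : Fin 3 → ∀ m : M, TangentSpace (𝓡∂ 4) m}
    (hY : ∀ᶠ y in 𝓝 z, IsAdaptedAt Y (fun y ↦ ι (e.symm y)) y) :
    ∀ᶠ y in 𝓝 z, components (pullback (𝓡∂ 4) (𝓡 3) ι q) e y =
      frameComponents Y q (ι (e.symm y)) := by
  filter_upwards [hY, e.open_target.mem_nhds hz] with y hy hye
  exact components_pullback he hye (h.mdifferentiableAt_ι _) hy q

theorem eventually_christoffel_eq_collarChristoffel (h : IsAsymptote g Φ ι Ω q N)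
    (hcollar : IsCollarFrame fr Ω (frameComponents fr q) O) (hzO : ι (e.symm z) ∈ O)
    (he : e ∈ IsManifold.maximalAtlas (𝓡 3) ∞ H) (hz : z ∈ e.target)
    (hfr : ∀ᶠ y in 𝓝 z, IsAdaptedAt (fun i : Fin 3 ↦ fr i.succ) (fun y ↦ ι (e.symm y)) y)
    (k i j : Fin 3) :
    christoffel (components (pullback (𝓡∂ 4) (𝓡 3) ι q) e) k i j =ᶠ[𝓝 z]
      collarChristoffel fr Ω (frameComponents fr q) k.succ i.succ j.succ ∘
        fun y ↦ ι (e.symm y) := by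
  have hO : ∀ᶠ y in 𝓝 z, ι (e.symm y) ∈ O :=
    hfr.self_of_nhds.mdifferentiableAt.continuousAt.eventually (hcollar.isOpen.mem_nhds hzO)
  filter_upwards [(h.eventually_components_eq_frameComponents he hz hfr).eventually_nhds, hfr, hO]
    with y hy hyfr hyO
  exact (hyfr.christoffel_eq (fun i j ↦ hcollar.mdifferentiableAt hyO
    (hcollar.contMDiffOn_q i.succ j.succ)) hy k i j).trans
    (hcollar.collarChristoffel_succ_succ_succ hyO (h.Ω_eq_zero _) k i j).symm

theorem ricciEq_pullback (h : IsAsymptote g Φ ι Ω q N) :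
    RicciEq (pullback (𝓡∂ 4) (𝓡 3) ι q) fun _ ↦ -2 := by
  intro e he z hz i j
  obtain ⟨s, fr, O, hzO, hfr, hadapted⟩ := h.exists_adaptedFrame he hz
  have hcomp := (h.eventually_components_eq_frameComponents he hz hadapted).self_of_nhds
  obtain ⟨O', hzO', hfr', hcollar⟩ := h.exists_isCollarFrame hfr hzO
    (hcomp ▸ det_components_ne_zero he hz (h.q_lorentzian _))
  have hric := hadapted.self_of_nhds.ricci_eq
    (fun k i j ↦ hcollar.mdifferentiableAt hzO' (hcollar.contMDiffOn_collarChristoffel _ _ _))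
    (h.eventually_christoffel_eq_collarChristoffel hcollar hzO' he hz hadapted) i j
  rw [hric, hcomp, hcollar.frameRicci_eq_of_ricci_physicalMetric_eq_zero h.dense_Ω_ne_zero
    (fun m hm hΩ ↦ h.frameRicci_physicalMetric_eq_zero hfr' hcollar hm hΩ) hzO' (h.Ω_eq_zero _)]
  norm_num [frameComponents]

end Boundary

theorem digamma_eq_neg_one (h : IsAsymptote g Φ ι Ω q N) (p : H) : digamma Ω N (ι p) = -1 := by
  let e := chartAt (EuclideanSpace ℝ (Fin 3)) p
  have hp : e.symm (e p) = p := e.left_inv (mem_chart_source _ p)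
  obtain ⟨s, fr, O, hO, hfr, -⟩ := h.exists_adaptedFrame
    (IsManifold.chart_mem_maximalAtlas p) (mem_chart_target _ p)
  exact h.digamma_eq_neg_one_of_mem hfr (hp ▸ hO)

end IsAsymptote

end Asymptote

end SpatialInfinity

end

open SpatialInfinity in
theorem mainTheorem3_general {X M H : Type*}
    [TopologicalSpace X] [ChartedSpace (EuclideanSpace ℝ (Fin 4)) X] [IsManifold (𝓡 4) ∞ X]
    [TopologicalSpace M] [ChartedSpace (EuclideanHalfSpace 4) M] [IsManifold (𝓡∂ 4) ∞ M]
    [TopologicalSpace H] [ChartedSpace (EuclideanSpace ℝ (Fin 3)) H] [IsManifold (𝓡 3) ∞ H]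
    (g : BilinField (𝓡 4) X) (Φ : X ≃ₘ^∞⟮𝓡 4, 𝓡∂ 4⟯ (interiorOpens M)) (ι : H → M)
    (Ω : M → ℝ) (q : BilinField (𝓡∂ 4) M) (N : ∀ p : M, TangentSpace (𝓡∂ 4) p)
    (h : IsAsymptote g Φ ι Ω q N) :
    (∀ p : H, digamma Ω N (ι p) = -1) ∧
      RicciEq (pullback (𝓡∂ 4) (𝓡 3) ι q) (fun _ ↦ -2) :=
  ⟨h.digamma_eq_neg_one, h.ricciEq_pullback⟩

open SpatialInfinity in
theorem mainTheorem3 {X M H : Type*}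
    [TopologicalSpace X] [ChartedSpace (EuclideanSpace ℝ (Fin 4)) X] [IsManifold (𝓡 4) ∞ X]
    [TopologicalSpace M] [ChartedSpace (EuclideanHalfSpace 4) M] [IsManifold (𝓡∂ 4) ∞ M]
    [TopologicalSpace H] [ChartedSpace (EuclideanSpace ℝ (Fin 3)) H] [IsManifold (𝓡 3) ∞ H]
    (g : BilinField (𝓡 4) X) (Φ : X ≃ₘ^∞⟮𝓡 4, 𝓡∂ 4⟯ (interiorOpens M)) (ι : H → M)
    (Ω : M → ℝ) (q : BilinField (𝓡∂ 4) M) (N : ∀ p : M, TangentSpace (𝓡∂ 4) p)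
    (h : IsAMSI g Φ ι Ω q N) :
    (∃ c : ℝ, ∀ p : H, digamma Ω N (ι p) = c) ∧
      RicciEq (pullback (𝓡∂ 4) (𝓡 3) ι q) (fun p : H ↦ 2 * digamma Ω N (ι p)) ∧
      IsEinstein (pullback (𝓡∂ 4) (𝓡 3) ι q) := by
  obtain ⟨hF, hric⟩ := mainTheorem3_general g Φ ι Ω q N h.toIsAsymptote
  exact ⟨⟨-1, hF⟩, by simpa only [hF, mul_neg_one] using hric, -2, hric⟩
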